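/- Let $N\ge 0$ and $n\ge 1$ be integers, and let $E=\mathbb R^N\times\mathbb R\to\mathbb R^N$ be the trivial line bundle. Its infinite jet bundle has coordinates $x^i$ ($1\le i\le N$) and $u_J$ ($J\in\mathbb Z_{\ge0}^N$). Let $\mathrm{Loc}(E)$ be the algebra of local functions, i.e. smooth real functions of the $x^i$ and of finitely many of the $u_J$, and let $$\frac{d}{dx^i}=\frac{\partial}{\partial x^i}+\sum_J u_{iJ}\frac{\partial}{\partial u_J}$$ be the total derivatives, where $iJ$ is $J$ with its $i$-th entry raised by $1$. For a finitely supported function $\alpha$ from multi-indices to $\mathbb Z_{\ge 0}$ put $(\partial/\partial\mathbf u)^\alpha=\prod_J(\partial/\partial u_J)^{\alpha(J)}$ and $\deg_f(\alpha)=\max\{|J| : \alpha(J)\ne0\}$ (and $0$ if $\alpha=0$). Let $\mathrm{LDO}(n)$ be the real vector space of $n$-linear maps $A:\mathrm{Loc}(E)^{\otimes n}\to\mathrm{Loc}(E)$ of the form $$A(f_1,\dots,f_n)=\sum p_{I_1,\dots,I_n,\alpha_1,\dots,\alpha_n}\prod_{j=1}^n\Big(\frac{d}{d\mathbf x}\Big)^{I_j}\Big(\frac{\partial}{\partial\mathbf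 u}\Big)^{\alpha_j}f_j ,\qquad p_{I_1,\dots,\alpha_n}\in\mathrm{Loc}(E),$$ such that for each $m$ only finitely many coefficients with $\sum_j\deg_f(\alpha_j)\le m$ are nonzero. Writing $d/dx^i_j$ for $d/dx^i$ acting on the $j$-th argument, put $d/d\mathbf y_1=d/d\mathbf x_1+\dots+d/d\mathbf x_n$ and $d/d\mathbf y_j=d/d\mathbf x_j$ for $j\ge2$. Each $A\in \mathrm{LDO}(n)$ has a unique polarized form $$A=\sum q_{I_1,\dots,I_n;\alpha_1,\dots,\alpha_n}\Big(\frac d{d\mathbf y_1}\Big)^{I_1}\cdots\Big(\frac d{d\mathbf y_n}\Big)^{I_n}\Big(\frac\partial{\partial\mathbf u_1}\Big)^{\alpha_1}\cdots\Big(\frac\partial{\partial\mathbf u_n}\Big)^{\alpha_n},$$ and its characteristic is $$\chi(A)=\sum(-1)^{|I_1|}\Big(\Big(\frac d{d\mathbf x}\Big)^{I_1}q_{I_1,\dots,I_n;\alpha_1,\dots,\alpha_n}\Big)\Big(\frac d{d\mathbf y_2}\Big)^{I_2}\cdots\Big(\frac d{d\mathbf y_n}\Big)^{I_n}\Big(\frac\partial{\partial\mathbf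 u_1}\Big)^{\alpha_1}\cdots\Big(\frac\partial{\partial\mathbf u_n}\Big)^{\alpha_n}\in\mathrm{LDO}(n).$$ Let $a_0:\mathrm{LDO}(n)\to\mathrm{LDO}(n)^{\oplus Nn}$ be the linear map $a_0(A)_{i,j}=\chi\big(A\circ\frac{d}{dx^i_j}\big)$. Let $\Omega_s$ ($0\le s\le N$) be the space of horizontal $(N-s)$-forms $\sum_\epsilon \omega_\epsilon (d\mathbf x)^\epsilon$, $\omega_\epsilon\in\mathrm{Loc}(E)$, with the horizontal differential $d_H\omega=\sum_i dx^i\wedge\frac{d}{dx^i}\omega$, which makes $(\Omega_*,d_H)$ a chain complex. For $k\in\mathbb Z$ let $\mathrm{DEnd}_k(n)$ be the space of linear maps $f:\Omega_*^{\otimes n}\to\Omega_*$ of degree $k$, $f=\{f_s:[\Omega_*^{\otimes n}]_s\to\Omega_{s+k}\}$, all of whose matrix coefficients with respect to the forms $(d\mathbf x)^\epsilon$ lie in $\mathrm{LDO}(n)$. The differential $\delta:\mathrm{DEnd}_k(n)\to\mathrm{DEnd}_{k-1}(n)$ is $\delta f=d_H\circ f-(-1)^kf\circ d_H^{\otimes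 n}$, where $d_H^{\otimes n}$ is the usual differential of the tensor product complex. Let $\mathcal B_0:\mathrm{DEnd}_0(n)\to\mathrm{LDO}(n)$ be $\mathcal B_0(f)=f_0$, where $[\Omega_*^{\otimes n}]_0$ and $\Omega_0$ are identified with $\mathrm{Loc}(E)^{\otimes n}$ and $\mathrm{Loc}(E)$ by means of $dx^1\wedge\dots\wedge dx^N$. Then: (i) $H_k(\mathrm{DEnd}_*(n),\delta)=0$ for all $k>0$. (ii) $\{A\in\mathrm{LDO}(n):\chi(A)=0\}\subseteq\operatorname{Ker}(a_0)$, and $\mathcal B_0$ induces an isomorphism $$H_0(\mathrm{DEnd}_*(n),\delta)\;\cong\;\frac{\{A\in\mathrm{LDO}(n):\ \chi(A\,\frac{d}{dx^i_j})=0\text{ for all }1\le i\le N,\ 1\le j\le n\}}{\{A\in\mathrm{LDO}(n):\ \chi(A)=0\}} ,\qquad [f]\mapsto[\mathcal B_0(f)].$$ (iii) $\mathcal B_0$ maps the $0$-cycles of $(\mathrm{DEnd}_*(n),\delta)$ onto $\operatorname{Ker}(a_0)$, i.e. $\mathcal B_0(Z_0(\mathrm{DEnd}_*(n)))=\operatorname{Ker}(a_0)$.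 -/

import Mathlib

namespace JetLDO

open scoped ContDiff

/-- Multi-indices `J = (j₁, …, j_N)`; the order `|J|` is `Finsupp.degree J`. -/
abbrev MIdx (N : ℕ) : Type := Fin N →₀ ℕ

/-- Points of the infinite jet bundle of the trivial line bundle over `ℝ^N`, given by the
coordinates `x^i` and `u_J`. -/
abbrev Jet (N : ℕ) : Type := (Fin N → ℝ) × (MIdx N → ℝ)

/-- The projection of the jet space to the coordinates `x^i` and the `u_J` with `J ∈ S`. -/
def Jet.proj {N : ℕ} (S : Finset (MIdx N)) : Jet N →ₗ[ℝ] (Fin N → ℝ) × (S → ℝ) where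
  toFun z := (z.1, fun J => z.2 J)
  map_add' _ _ := rfl
  map_smul' _ _ := rfl

/-- `f` is a smooth function of the coordinates `x^i` and of the `u_J` with `J ∈ S`. -/
def DependsSmoothlyOn {N : ℕ} (S : Finset (MIdx N)) (f : Jet N → ℝ) : Prop :=
  ∃ g : (Fin N → ℝ) × (S → ℝ) → ℝ, ContDiff ℝ ∞ g ∧ ∀ z, f z = g (Jet.proj S z)

theorem DependsSmoothlyOn.mono {N : ℕ} {S T : Finset (MIdx N)} (h : S ⊆ T) {f : Jet N → ℝ}
    (hf : DependsSmoothlyOn S f) : DependsSmoothlyOn T f := by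
  obtain ⟨g, hg, hfg⟩ := hf
  refine ⟨fun w => g (w.1, fun J => w.2 ⟨J, h J.2⟩), ?_, fun z => hfg z⟩
  exact hg.comp (contDiff_fst.prodMk (contDiff_pi.2 fun J => (contDiff_apply ℝ ℝ _).comp contDiff_snd))

/-- The algebra of local functions: smooth functions of the `x^i` and of finitely many of the `u_J`. -/
def locSubalgebra (N : ℕ) : Subalgebra ℝ (Jet N → ℝ) where
  carrier := {f | ∃ S, DependsSmoothlyOn S f}
  mul_mem' := by
    classical
    rintro a b ⟨S, hS⟩ ⟨T, hT⟩
    obtain ⟨g, hg, h1⟩ := hS.mono (Finset.subset_union_left (s₂ := T))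
    obtain ⟨g', hg', h2⟩ := hT.mono (Finset.subset_union_right (s₁ := S))
    exact ⟨S ∪ T, fun w => g w * g' w, hg.mul hg', fun z => by simp [h1, h2]⟩
  add_mem' := by
    classical
    rintro a b ⟨S, hS⟩ ⟨T, hT⟩
    obtain ⟨g, hg, h1⟩ := hS.mono (Finset.subset_union_left (s₂ := T))
    obtain ⟨g', hg', h2⟩ := hT.mono (Finset.subset_union_right (s₁ := S))
    exact ⟨S ∪ T, fun w => g w + g' w, hg.add hg', fun z => by simp [h1, h2]⟩
  algebraMap_mem' r := ⟨∅, fun _ => r, contDiff_const, fun _ => rfl⟩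

/-- The commutative `ℝ`-algebra `Loc(E)` of local functions. -/
def Loc (N : ℕ) : Type := locSubalgebra N

instance (N : ℕ) : CommRing (Loc N) := inferInstanceAs (CommRing (locSubalgebra N))

instance (N : ℕ) : Algebra ℝ (Loc N) := inferInstanceAs (Algebra ℝ (locSubalgebra N))

instance (N : ℕ) : FunLike (Loc N) (Jet N) ℝ where
  coe f := f.1
  coe_injective := fun _ _ h => Subtype.ext h

@[ext] theorem Loc.ext {N : ℕ} {f g : Loc N} (h : ∀ z, f z = g z) : f = g := DFunLike.ext f g h

theorem Loc.exists_dependsOn {N : ℕ} (f : Loc N) : ∃ S, DependsSmoothlyOn S f := f.2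

theorem DependsSmoothlyOn.hasLineDerivAt {N : ℕ} {S : Finset (MIdx N)}
    {g : (Fin N → ℝ) × (S → ℝ) → ℝ} (hg : ContDiff ℝ ∞ g) (z v : Jet N) :
    HasLineDerivAt ℝ (fun z => g (Jet.proj S z)) (fderiv ℝ g (Jet.proj S z) (Jet.proj S v)) z v := by
  have h := ((hg.differentiable (by simp)) (Jet.proj S z)).hasFDerivAt.hasLineDerivAt (Jet.proj S v)
  unfold HasLineDerivAt at h ⊢
  simpa [map_add, map_smul] using h

theorem DependsSmoothlyOn.lineDeriv {N : ℕ} {S : Finset (MIdx N)} {f : Jet N → ℝ}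
    (hf : DependsSmoothlyOn S f) (v : Jet N) :
    DependsSmoothlyOn S (fun z => lineDeriv ℝ f z v) := by
  obtain ⟨g, hg, hfg⟩ := hf
  obtain rfl : f = fun z => g (Jet.proj S z) := funext hfg
  refine ⟨fun w => fderiv ℝ g w (Jet.proj S v), ?_, fun z =>
    (DependsSmoothlyOn.hasLineDerivAt hg z v).lineDeriv⟩
  exact (hg.fderiv_right (m := ∞) (by simp)).clm_apply contDiff_const

theorem Loc.lineDiff {N : ℕ} (f : Loc N) (z v : Jet N) :
    LineDifferentiableAt ℝ (f : Jet N → ℝ) z v := by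
  obtain ⟨S, g, hg, hfg⟩ := f.exists_dependsOn
  rw [show (f : Jet N → ℝ) = fun z => g (Jet.proj S z) from funext hfg]
  exact (DependsSmoothlyOn.hasLineDerivAt hg z v).lineDifferentiableAt

/-- The derivative of local functions in a constant direction `v`. -/
noncomputable def dirDeriv {N : ℕ} (v : Jet N) : Derivation ℝ (Loc N) (Loc N) where
  toFun f := ⟨fun z => lineDeriv ℝ (f : Jet N → ℝ) z v, by
    obtain ⟨S, hS⟩ := f.exists_dependsOn
    exact ⟨S, hS.lineDeriv v⟩⟩
  map_add' f g := by
    ext z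
    exact (HasDerivAt.add (Loc.lineDiff f z v).hasLineDerivAt
      (Loc.lineDiff g z v).hasLineDerivAt).deriv
  map_smul' c f := by
    ext z
    exact (HasDerivAt.const_smul c (Loc.lineDiff f z v).hasLineDerivAt).deriv
  map_one_eq_zero' := by
    ext z
    exact deriv_const _ _
  leibniz' f g := by
    ext z
    have := (HasDerivAt.mul (Loc.lineDiff f z v).hasLineDerivAt
      (Loc.lineDiff g z v).hasLineDerivAt).deriv
    simp only [zero_smul, add_zero] at this
    exact this.trans (show _ = (f : Jet N → ℝ) z * lineDeriv ℝ (g : Jet N → ℝ) z v +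
      (g : Jet N → ℝ) z * lineDeriv ℝ (f : Jet N → ℝ) z v by ring)

theorem dirDeriv_apply {N : ℕ} (v : Jet N) (f : Loc N) (z : Jet N) :
    (dirDeriv v f : Jet N → ℝ) z = lineDeriv ℝ (f : Jet N → ℝ) z v := rfl

theorem dirDeriv_comm {N : ℕ} (v w : Jet N) (f : Loc N) :
    dirDeriv v (dirDeriv w f) = dirDeriv w (dirDeriv v f) := by
  obtain ⟨S, g, hg, hfg⟩ := f.exists_dependsOn
  have h0 : (f : Jet N → ℝ) = fun z => g (Jet.proj S z) := funext hfg
  have key : ∀ (v w z : Jet N), (dirDeriv v (dirDeriv w f) : Jet N → ℝ) z =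
      fderiv ℝ (fderiv ℝ g) (Jet.proj S z) (Jet.proj S v) (Jet.proj S w) := by
    intro v w z
    have hd : ContDiff ℝ ∞ (fderiv ℝ g) := hg.fderiv_right (m := ∞) (by simp)
    have h1 : (dirDeriv w f : Jet N → ℝ) = fun z =>
        (fun y => fderiv ℝ g y (Jet.proj S w)) (Jet.proj S z) := by
      funext z
      rw [dirDeriv_apply, h0]
      exact (DependsSmoothlyOn.hasLineDerivAt hg z w).lineDeriv
    rw [dirDeriv_apply, h1, (DependsSmoothlyOn.hasLineDerivAt
      (hd.clm_apply contDiff_const) z v).lineDeriv]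
    rw [fderiv_clm_apply (hd.differentiable (by simp) _) (by fun_prop)]
    simp
  ext z
  rw [key, key]
  exact (hg.contDiffAt.isSymmSndFDerivAt (by simpa using WithTop.coe_le_coe.2 (le_top : (2 : ℕ∞) ≤ ⊤))) _ _

/-- The coordinate function `u_J`. -/
def uCoord {N : ℕ} (J : MIdx N) : Loc N :=
  ⟨fun z => z.2 J, {J}, fun w => w.2 ⟨J, by simp⟩,
    (contDiff_apply ℝ ℝ _).comp contDiff_snd, fun _ => rfl⟩

/-- The coordinate function `x^i`. -/
def xCoord {N : ℕ} (i : Fin N) : Loc N :=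
  ⟨fun z => z.1 i, ∅, fun w => w.1 i, (contDiff_apply ℝ ℝ _).comp contDiff_fst, fun _ => rfl⟩

theorem uCoord_apply {N : ℕ} (J : MIdx N) (z : Jet N) : uCoord J z = z.2 J := rfl

theorem xCoord_apply {N : ℕ} (i : Fin N) (z : Jet N) : xCoord i z = z.1 i := rfl

/-- The partial derivative `∂/∂x^i` of local functions. -/
noncomputable def pdX {N : ℕ} (i : Fin N) : Derivation ℝ (Loc N) (Loc N) :=
  dirDeriv (Pi.single i 1, 0)

open Classical in
/-- The partial derivative `∂/∂u_J` of local functions. -/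
noncomputable def pdU {N : ℕ} (J : MIdx N) : Derivation ℝ (Loc N) (Loc N) :=
  dirDeriv (0, Pi.single J 1)

theorem pdU_eq_zero {N : ℕ} {S : Finset (MIdx N)} {f : Loc N}
    (hf : DependsSmoothlyOn S (f : Jet N → ℝ)) {J : MIdx N} (hJ : J ∉ S) : pdU J f = 0 := by
  classical
  obtain ⟨g, hg, hfg⟩ := hf
  ext z
  rw [pdU, dirDeriv_apply, show (f : Jet N → ℝ) = fun z => g (Jet.proj S z) from funext hfg,
    (DependsSmoothlyOn.hasLineDerivAt hg z _).lineDeriv]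
  have : Jet.proj S ((0, Pi.single J 1) : Jet N) = 0 := by
    ext K
    · rfl
    · have : (K : MIdx N) ≠ J := fun h => hJ (h ▸ K.2)
      simp [Jet.proj, Pi.single_apply, this]
  rw [this, map_zero]
  rfl

theorem pdU_uCoord {N : ℕ} (J K : MIdx N) [Decidable (K = J)] :
    pdU J (uCoord K) = if K = J then 1 else 0 := by
  classical
  ext z
  have : HasLineDerivAt ℝ (uCoord K : Jet N → ℝ) (if K = J then 1 else 0) z (0, Pi.single J 1) := by
    have h : HasDerivAt (fun t : ℝ => z.2 K + t * (if K = J then 1 else 0)) (if K = J then 1 else 0) 0 := by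
      simpa using ((hasDerivAt_id (0:ℝ)).mul_const (if K = J then (1:ℝ) else 0)).const_add (z.2 K)
    refine h.congr_of_eventuallyEq (.of_forall fun t => ?_)
    simp [uCoord_apply, Pi.single_apply]
  have h3 : (pdU J (uCoord K) : Jet N → ℝ) z = if K = J then 1 else 0 := by
    rw [← this.lineDeriv, pdU, dirDeriv_apply]
  rw [h3]
  split_ifs <;> rfl

theorem pdX_uCoord {N : ℕ} (i : Fin N) (K : MIdx N) : pdX i (uCoord K) = 0 := by
  ext z
  have : HasLineDerivAt ℝ (uCoord K : Jet N → ℝ) 0 z (Pi.single i 1, 0) := by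
    have h : HasDerivAt (fun _ : ℝ => z.2 K) 0 0 := hasDerivAt_const _ _
    refine h.congr_of_eventuallyEq (.of_forall fun t => ?_)
    simp [uCoord_apply]
  exact this.lineDeriv

theorem pdU_xCoord {N : ℕ} (J : MIdx N) (i : Fin N) : pdU J (xCoord i) = 0 :=
  pdU_eq_zero (S := ∅) ⟨fun w => w.1 i, (contDiff_apply ℝ ℝ _).comp contDiff_fst, fun _ => rfl⟩ (by simp)

theorem pdX_xCoord {N : ℕ} (i k : Fin N) : pdX i (xCoord k) = if k = i then 1 else 0 := by
  ext z
  have : HasLineDerivAt ℝ (xCoord k : Jet N → ℝ) (if k = i then 1 else 0) z (Pi.single i 1, 0) := by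
    have h : HasDerivAt (fun t : ℝ => z.1 k + t * (if k = i then 1 else 0)) (if k = i then 1 else 0) 0 := by
      simpa using ((hasDerivAt_id (0:ℝ)).mul_const (if k = i then (1:ℝ) else 0)).const_add (z.1 k)
    refine h.congr_of_eventuallyEq (.of_forall fun t => ?_)
    simp [xCoord_apply, Pi.single_apply]
  have h3 : (pdX i (xCoord k) : Jet N → ℝ) z = if k = i then 1 else 0 := this.lineDeriv
  rw [h3]
  split_ifs <;> rfl

theorem finite_pdU {N : ℕ} (f : Loc N) : {J | pdU J f ≠ 0}.Finite := by
  obtain ⟨S, hS⟩ := f.exists_dependsOn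
  refine S.finite_toSet.subset fun J hJ => ?_
  by_contra h
  exact hJ (pdU_eq_zero hS h)

theorem finite_totD {N : ℕ} (i : Fin N) (f : Loc N) :
    (Function.support fun J : MIdx N => uCoord (J + Finsupp.single i 1) * pdU J f).Finite :=
  (finite_pdU f).subset fun J hJ h => hJ (by simp [h])

/-- The total derivative `d/dx^i = ∂/∂x^i + ∑_J u_{iJ} ∂/∂u_J` on local functions, where
`iJ` is `J` with its `i`-th entry raised by one. -/
noncomputable def totD {N : ℕ} (i : Fin N) : Derivation ℝ (Loc N) (Loc N) where
  toFun f := pdX i f + ∑ᶠ J : MIdx N, uCoord (J + Finsupp.single i 1) * pdU J f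
  map_add' f g := by
    simp only [map_add, mul_add]
    rw [finsum_add_distrib (finite_totD i f) (finite_totD i g)]
    abel
  map_smul' c f := by
    have h (J : MIdx N) : pdU J (c • f) = c • pdU J f := (pdU J).map_smul c f
    have h' : pdX i (c • f) = c • pdX i f := (pdX i).map_smul c f
    simp only [h, h', mul_smul_comm, RingHom.id_apply, smul_add, smul_finsum]
  map_one_eq_zero' := by simp
  leibniz' f g := by
    simp only [LinearMap.coe_mk, AddHom.coe_mk, Derivation.leibniz, smul_eq_mul, mul_add]
    rw [finsum_add_distrib, mul_finsum' _ _ (finite_totD i g),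
      mul_finsum' _ _ (finite_totD i f)]
    · simp only [mul_left_comm]
      abel
    · exact (finite_totD i g).subset fun J hJ h => hJ (by simp only [mul_left_comm]; simp [h])
    · exact (finite_totD i f).subset fun J hJ h => hJ (by simp only [mul_left_comm]; simp [h])

theorem totD_apply {N : ℕ} (i : Fin N) (f : Loc N) :
    totD i f = pdX i f + ∑ᶠ J : MIdx N, uCoord (J + Finsupp.single i 1) * pdU J f := rfl

theorem totD_eq_sum {N : ℕ} (i : Fin N) (f : Loc N) (T : Finset (MIdx N))
    (hT : ∀ J ∉ T, pdU J f = 0) :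
    totD i f = pdX i f + ∑ J ∈ T, uCoord (J + Finsupp.single i 1) * pdU J f := by
  rw [totD_apply, finsum_eq_sum_of_support_subset]
  intro J hJ
  by_contra h
  exact hJ (by simp [hT J h])

theorem totD_uCoord {N : ℕ} (i : Fin N) (K : MIdx N) :
    totD i (uCoord K) = uCoord (K + Finsupp.single i 1) := by
  classical
  rw [totD_eq_sum i _ {K} fun J hJ => by
    rw [pdU_uCoord, if_neg]; exact fun h => hJ (by simp [h])]
  simp [pdX_uCoord, pdU_uCoord]

theorem totD_xCoord {N : ℕ} (i k : Fin N) :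
    totD i (xCoord k) = if k = i then 1 else 0 := by
  rw [totD_eq_sum i _ ∅ fun J hJ => pdU_xCoord J k]
  simp [pdX_xCoord]

theorem pdU_comm {N : ℕ} (J K : MIdx N) (f : Loc N) : pdU J (pdU K f) = pdU K (pdU J f) :=
  dirDeriv_comm _ _ f

theorem pdU_pdX {N : ℕ} (J : MIdx N) (i : Fin N) (f : Loc N) :
    pdU J (pdX i f) = pdX i (pdU J f) :=
  dirDeriv_comm _ _ f

theorem pdX_comm {N : ℕ} (i k : Fin N) (f : Loc N) : pdX k (pdX i f) = pdX i (pdX k f) :=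
  dirDeriv_comm _ _ f

/-- `∂/∂u_J` and `d/dx^i` commute up to `∂/∂u_K` with `J = iK`. -/
theorem pdU_totD {N : ℕ} (J : MIdx N) (i : Fin N) (f : Loc N) :
    pdU J (totD i f) = totD i (pdU J f) +
      if J i = 0 then 0 else pdU (J - Finsupp.single i 1) f := by
  classical
  obtain ⟨S, hS⟩ := f.exists_dependsOn
  have h1 : ∀ K ∉ S, pdU K f = 0 := fun K hK => pdU_eq_zero hS hK
  have h2 : ∀ K ∉ S, pdU K (pdU J f) = 0 := fun K hK => by rw [pdU_comm, h1 K hK, map_zero]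
  rw [totD_eq_sum i f S h1, totD_eq_sum i _ S h2, map_add, map_sum, pdU_pdX, add_assoc]
  congr 1
  have h3 : ∀ K ∈ S, pdU J (uCoord (K + Finsupp.single i 1) * pdU K f) =
      uCoord (K + Finsupp.single i 1) * pdU K (pdU J f) +
        if K + Finsupp.single i 1 = J then pdU K f else 0 := by
    intro K _
    rw [Derivation.leibniz, pdU_uCoord, pdU_comm]
    simp
  rw [Finset.sum_congr rfl h3, Finset.sum_add_distrib]
  congr 1
  split_ifs with hJ
  · refine Finset.sum_eq_zero fun K _ => if_neg fun h => ?_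
    rw [← h] at hJ
    simp at hJ
  · have h4 : ∀ K, K + Finsupp.single i 1 = J ↔ K = J - Finsupp.single i 1 := by
      intro K
      constructor
      · rintro rfl; simp
      · rintro rfl
        exact tsub_add_cancel_of_le (by simpa [Finsupp.single_le_iff] using Nat.one_le_iff_ne_zero.2 hJ)
    simp only [h4, Finset.sum_ite_eq']
    split_ifs with h5
    · rfl
    · exact (h1 _ h5).symm

theorem pdX_totD {N : ℕ} (i k : Fin N) (f : Loc N) : pdX k (totD i f) = totD i (pdX k f) := by
  obtain ⟨S, hS⟩ := f.exists_dependsOn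
  have h1 : ∀ K ∉ S, pdU K f = 0 := fun K hK => pdU_eq_zero hS hK
  have h2 : ∀ K ∉ S, pdU K (pdX k f) = 0 := fun K hK => by rw [pdU_pdX, h1 K hK, map_zero]
  rw [totD_eq_sum i f S h1, totD_eq_sum i _ S h2, map_add, map_sum, pdX_comm]
  congr 1
  refine Finset.sum_congr rfl fun K _ => ?_
  rw [Derivation.leibniz, pdX_uCoord, pdU_pdX]
  simp

theorem totD_comm {N : ℕ} (i k : Fin N) (f : Loc N) : totD i (totD k f) = totD k (totD i f) := by
  classical
  obtain ⟨S, hS⟩ := f.exists_dependsOn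
  have h1 : ∀ K ∉ S, pdU K f = 0 := fun K hK => pdU_eq_zero hS hK
  set T := S ∪ S.image (fun K => K + Finsupp.single k 1) with hT
  have hST : S ⊆ T := Finset.subset_union_left
  have hT1 : ∀ K ∉ T, pdU K f = 0 := fun K hK => h1 K fun h => hK (hST h)
  have hJ : ∀ J ∉ T, pdU J (totD k f) = 0 := by
    intro J hJ
    rw [pdU_totD, hT1 J hJ, map_zero, zero_add]
    split_ifs with h0
    · rfl
    · refine h1 _ fun h => hJ ?_
      rw [hT, Finset.mem_union, Finset.mem_image]
      exact Or.inr ⟨_, h, tsub_add_cancel_of_le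
        (by simpa [Finsupp.single_le_iff] using Nat.one_le_iff_ne_zero.2 h0)⟩
  rw [totD_eq_sum i (totD k f) T hJ, totD_eq_sum i f T hT1, map_add, map_sum, pdX_totD]
  congr 1
  simp only [pdU_totD, Derivation.leibniz, totD_uCoord, smul_eq_mul, mul_add,
    Finset.sum_add_distrib]
  congr 1
  have h5 : ∑ J ∈ T, pdU J f * uCoord (J + Finsupp.single i 1 + Finsupp.single k 1) =
      ∑ J ∈ S, pdU J f * uCoord (J + Finsupp.single i 1 + Finsupp.single k 1) :=
    (Finset.sum_subset hST fun J _ h => by rw [h1 J h, zero_mul]).symm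
  rw [h5]
  symm
  refine Finset.sum_of_injOn (fun K => K + Finsupp.single k 1) (by simp) ?_ ?_ ?_
  · intro K hK
    rw [hT]
    simp only [Finset.coe_union, Finset.coe_image]
    exact Or.inr ⟨K, hK, rfl⟩
  · intro J _ h
    split_ifs with h0
    · simp
    · rw [h1, mul_zero]
      exact fun h6 => h ⟨_, h6, tsub_add_cancel_of_le
        (by simpa [Finsupp.single_le_iff] using Nat.one_le_iff_ne_zero.2 h0)⟩
  · intro K _
    simp [mul_comm, add_right_comm]

theorem pairwise_commute_pow {ι M : Type*} [Monoid M] {T : ι → M}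
    (hT : ∀ i k, Commute (T i) (T k)) (α : ι →₀ ℕ) (s : Set ι) :
    s.Pairwise (Function.onFun Commute fun i => T i ^ α i) :=
  fun i _ k _ _ => (hT i k).pow_pow _ _

/-- The product `∏ᵢ (T i)^(α i)` of powers of pairwise commuting elements. -/
def opPow {ι M : Type*} [Monoid M] (T : ι → M) (hT : ∀ i k, Commute (T i) (T k)) (α : ι →₀ ℕ) : M :=
  α.support.noncommProd (fun i => T i ^ α i) (pairwise_commute_pow hT α _)

theorem opPow_of_subset {ι M : Type*} [Monoid M] (T : ι → M) (hT : ∀ i k, Commute (T i) (T k))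
    (α : ι →₀ ℕ) (s : Finset ι) (hs : α.support ⊆ s) :
    opPow T hT α = s.noncommProd (fun i => T i ^ α i) (pairwise_commute_pow hT α _) := by
  classical
  obtain ⟨t, rfl, hd⟩ : ∃ t, s = α.support ∪ t ∧ Disjoint α.support t :=
    ⟨s \ α.support, (Finset.union_sdiff_of_subset hs).symm, Finset.disjoint_sdiff⟩
  rw [Finset.noncommProd_union_of_disjoint hd, opPow]
  convert (mul_one _).symm
  rw [Finset.noncommProd_eq_pow_card _ _ _ 1, one_pow]
  intro i hi
  rw [Finsupp.notMem_support_iff.1 (Finset.disjoint_right.1 hd hi), pow_zero]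

theorem opPow_zero {ι M : Type*} [Monoid M] (T : ι → M)
    (hT : ∀ i k, Commute (T i) (T k)) : opPow T hT 0 = 1 := by
  rw [opPow_of_subset T hT 0 ∅ (by simp)]
  exact Finset.noncommProd_empty _ _

theorem opPow_single {ι M : Type*} [Monoid M] (T : ι → M)
    (hT : ∀ i k, Commute (T i) (T k)) (i : ι) : opPow T hT (Finsupp.single i 1) = T i := by
  classical
  rw [opPow_of_subset T hT _ {i} Finsupp.support_single_subset]
  simp

theorem opPow_add {ι M : Type*} [Monoid M] (T : ι → M) (hT : ∀ i k, Commute (T i) (T k))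
    (α β : ι →₀ ℕ) : opPow T hT (α + β) = opPow T hT α * opPow T hT β := by
  classical
  rw [opPow_of_subset T hT (α + β) (α.support ∪ β.support) Finsupp.support_add,
    opPow_of_subset T hT α (α.support ∪ β.support) Finset.subset_union_left,
    opPow_of_subset T hT β (α.support ∪ β.support) Finset.subset_union_right,
    ← Finset.noncommProd_mul_distrib]
  · refine Finset.noncommProd_congr rfl (fun i _ => ?_) _
    simp [pow_add]
  · exact fun i _ k _ _ => (hT i k).pow_pow _ _

/-- `d/dx^i` as an `ℝ`-linear endomorphism. -/
noncomputable def totDEnd {N : ℕ} (i : Fin N) : Module.End ℝ (Loc N) := (totD i).toLinearMap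

/-- `∂/∂u_J` as an `ℝ`-linear endomorphism. -/
noncomputable def pdUEnd {N : ℕ} (J : MIdx N) : Module.End ℝ (Loc N) := (pdU J).toLinearMap

theorem commute_totDEnd {N : ℕ} (i k : Fin N) : Commute (totDEnd i) (totDEnd k) :=
  LinearMap.ext (totD_comm i k)

theorem commute_pdUEnd {N : ℕ} (J K : MIdx N) : Commute (pdUEnd J) (pdUEnd K) :=
  LinearMap.ext (pdU_comm J K)

/-- `(d/dx)^I = ∏ᵢ (d/dx^i)^(I i)`. -/
noncomputable def totDPow {N : ℕ} (I : Fin N →₀ ℕ) : Module.End ℝ (Loc N) :=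
  opPow totDEnd commute_totDEnd I

/-- `(∂/∂u)^α = ∏_J (∂/∂u_J)^{α(J)}`. -/
noncomputable def pdUPow {N : ℕ} (α : MIdx N →₀ ℕ) : Module.End ℝ (Loc N) :=
  opPow pdUEnd commute_pdUEnd α

theorem totDPow_zero {N : ℕ} (f : Loc N) : totDPow 0 f = f := by rw [totDPow, opPow_zero]; rfl

theorem totDPow_add_single {N : ℕ} (I : Fin N →₀ ℕ) (i : Fin N) (f : Loc N) :
    totDPow (I + Finsupp.single i 1) f = totDPow I (totD i f) := by
  rw [totDPow, opPow_add, opPow_single]; rfl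

theorem totDPow_add_single' {N : ℕ} (I : Fin N →₀ ℕ) (i : Fin N) (f : Loc N) :
    totDPow (I + Finsupp.single i 1) f = totD i (totDPow I f) := by
  rw [add_comm]
  rw [totDPow, opPow_add, opPow_single]; rfl

theorem pdUPow_zero {N : ℕ} (f : Loc N) : pdUPow 0 f = f := by rw [pdUPow, opPow_zero]; rfl

theorem pdUPow_add_single {N : ℕ} (α : MIdx N →₀ ℕ) (J : MIdx N) (f : Loc N) :
    pdUPow (α + Finsupp.single J 1) f = pdUPow α (pdU J f) := by
  rw [pdUPow, opPow_add, opPow_single]; rfl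

theorem pdUPow_add_single' {N : ℕ} (α : MIdx N →₀ ℕ) (J : MIdx N) (f : Loc N) :
    pdUPow (α + Finsupp.single J 1) f = pdU J (pdUPow α f) := by
  rw [add_comm]
  rw [pdUPow, opPow_add, opPow_single]; rfl

theorem pdUPow_eq_zero {N : ℕ} (α : MIdx N →₀ ℕ) {J : MIdx N} (hJ : α J ≠ 0) {f : Loc N}
    (hf : pdU J f = 0) : pdUPow α f = 0 := by
  rw [← tsub_add_cancel_of_le (show Finsupp.single J 1 ≤ α by
    simpa [Finsupp.single_le_iff] using Nat.one_le_iff_ne_zero.2 hJ), pdUPow_add_single, hf, map_zero]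

theorem finsupp_nat_induction {ι : Type*} {p : (ι →₀ ℕ) → Prop} (h0 : p 0)
    (h1 : ∀ α i, p α → p (α + Finsupp.single i 1)) (α : ι →₀ ℕ) : p α := by
  suffices h : ∀ β α, p α → p (α + β) by simpa using h α 0 h0
  intro β
  induction β using Finsupp.induction_linear with
  | zero => simp
  | add β γ hβ hγ => intro α h; rw [← add_assoc]; exact hγ _ (hβ _ h)
  | single i b =>
    induction b with
    | zero => simp
    | succ b ih =>
      intro α h
      rw [Finsupp.single_add, ← add_assoc]
      exact h1 _ _ (ih _ h)

/-- The commutation of `(∂/∂u)^α` and `d/dx^i`. -/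
theorem pdUPow_totD {N : ℕ} (i : Fin N) (α : MIdx N →₀ ℕ) (f : Loc N) :
    pdUPow α (totD i f) = totD i (pdUPow α f) + α.sum fun J a => a • if J i = 0 then 0 else
      pdUPow (α - Finsupp.single J 1 + Finsupp.single (J - Finsupp.single i 1) 1) f := by
  classical
  induction α using finsupp_nat_induction generalizing f with
  | h0 => simp [pdUPow_zero]
  | h1 α K ih =>
    rw [pdUPow_add_single, pdU_totD, map_add, ih, add_assoc, ← pdUPow_add_single]
    congr 1
    rw [Finsupp.sum_of_support_subset (α + Finsupp.single K 1) (s := α.support ∪ {K})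
      (Finsupp.support_add.trans (Finset.union_subset_union_right Finsupp.support_single_subset)) _
      (by simp), Finsupp.sum_of_support_subset α (s := α.support ∪ {K}) Finset.subset_union_left _
      (by simp)]
    simp only [Finsupp.add_apply, add_smul, Finset.sum_add_distrib]
    congr 1
    · refine Finset.sum_congr rfl fun J _ => ?_
      by_cases hJ : α J = 0
      · simp [hJ]
      · congr 1
        split_ifs
        · rfl
        · rw [← pdUPow_add_single, add_right_comm, tsub_add_eq_add_tsub]
          simpa [Finsupp.single_le_iff] using Nat.one_le_iff_ne_zero.2 hJ
    · rw [Finset.sum_eq_single K]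
      · by_cases h : K i = 0 <;> simp [h, pdUPow_add_single]
      · intro J _ hJ
        simp [hJ.symm]
      · intro h
        simp at h

/-- `n`-linear maps `Loc(E)^{⊗n} → Loc(E)`. -/
abbrev MultiOp (N n : ℕ) : Type := MultilinearMap ℝ (fun _ : Fin n => Loc N) (Loc N)

/-- Exponents `(α₁, …, αₙ)` of the vertical derivatives of an `n`-multilinear operator. -/
abbrev VIdx (N n : ℕ) : Type := Fin n → (MIdx N →₀ ℕ)

/-- The formal differential degree: the maximal order `|J|` with `α(J) ≠ 0`. -/
noncomputable def formalDeg {N : ℕ} (α : MIdx N →₀ ℕ) : ℕ := α.support.sup Finsupp.degree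

/-- Polynomials with coefficients in `Loc(E)` in commuting variables indexed by `(j, i)`; the variable
`(j, i)` stands for `d/dx^i` acting on the `j`-th argument, so that the monomial with exponent `m`
stands for `(d/dx_1)^{I_1} ⋯ (d/dx_n)^{I_n}` with `I_j = m.curry j`. -/
abbrev HorPoly (N n : ℕ) : Type := MvPolynomial (Fin n × Fin N) (Loc N)

/-- The total symbols of `n`-multilinear local differential operators. The coefficient of
`(d/dx_1)^{I_1} ⋯ (d/dx_n)^{I_n} (∂/∂u_1)^{α_1} ⋯ (∂/∂u_n)^{α_n}` is the coefficient of the monomial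
`(I_1, …, I_n)` in the polynomial attached to `(α_1, …, α_n)`. For each `m` only finitely many
coefficients with `∑ deg_f(α_j) ≤ m` are nonzero. -/
def Symb (N n : ℕ) : Submodule ℝ (VIdx N n → HorPoly N n) where
  carrier := {c | ∀ m : ℕ, {α | ∑ j, formalDeg (α j) ≤ m ∧ c α ≠ 0}.Finite}
  zero_mem' m := by simp
  add_mem' {a b} ha hb m := by
    refine ((ha m).union (hb m)).subset fun α hα => ?_
    by_cases h : a α = 0
    · exact Or.inr ⟨hα.1, fun h' => hα.2 (by simp [h, h'])⟩
    · exact Or.inl ⟨hα.1, h⟩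
  smul_mem' r a ha m := by
    refine (ha m).subset fun α hα => ⟨hα.1, fun h => hα.2 ?_⟩
    simp [h]

/-- The linear map on polynomials which is given on the term `r ξ^m` by `b m r`. -/
noncomputable def coeffwise {σ R A : Type*} [CommRing R] [Algebra ℝ R] [AddCommMonoid A] [Module ℝ A]
    (b : (σ →₀ ℕ) → R →ₗ[ℝ] A) : MvPolynomial σ R →ₗ[ℝ] A where
  toFun P := ∑ m ∈ P.support, b m (P.coeff m)
  map_add' P Q := by
    classical
    rw [Finset.sum_subset (MvPolynomial.support_add (p := P) (q := Q)),
      Finset.sum_subset (s₁ := P.support) (Finset.subset_union_left (s₂ := Q.support)),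
      Finset.sum_subset (s₁ := Q.support) (Finset.subset_union_right (s₁ := P.support)),
      ← Finset.sum_add_distrib]
    · simp
    all_goals intro m _ hm; rw [MvPolynomial.notMem_support_iff.1 hm, map_zero]
  map_smul' r P := by
    rw [Finset.sum_subset (MvPolynomial.support_smul (a := r) (f := P)), RingHom.id_apply,
      Finset.smul_sum]
    · simp
    · intro m _ hm; rw [MvPolynomial.notMem_support_iff.1 hm, map_zero]

theorem coeffwise_monomial {σ R A : Type*} [CommRing R] [Algebra ℝ R] [AddCommMonoid A] [Module ℝ A]
    (b : (σ →₀ ℕ) → R →ₗ[ℝ] A) (m : σ →₀ ℕ) (r : R) :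
    coeffwise b (MvPolynomial.monomial m r) = b m r := by
  classical
  by_cases hr : r = 0
  · simp [hr]
  · simp [coeffwise, MvPolynomial.support_monomial, hr]

/-- The multilinear operator `(g_1, …, g_n) ↦ ∏_j (d/dx)^{I_j} g_j` with `I_j = m.curry j`. -/
noncomputable def horMon {N n : ℕ} (m : Fin n × Fin N →₀ ℕ) :
    MultiOp N n :=
  (MultilinearMap.mkPiAlgebra ℝ (Fin n) (Loc N)).compLinearMap fun j => totDPow (m.curry j)

theorem horMon_apply {N n : ℕ} (m : Fin n × Fin N →₀ ℕ) (g : Fin n → Loc N) :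
    horMon m g = ∏ j, totDPow (m.curry j) (g j) := by
  simp [horMon]

/-- The multilinear operator `p (d/dx_1)^{I_1} ⋯ (d/dx_n)^{I_n}`, as a linear function of `p`. -/
noncomputable def mulMon {N n : ℕ} (m : Fin n × Fin N →₀ ℕ) : Loc N →ₗ[ℝ] MultiOp N n where
  toFun p := (LinearMap.mulLeft ℝ p).compMultilinearMap (horMon m)
  map_add' p q := by ext1 g; exact add_mul p q _
  map_smul' r p := by ext1 g; exact smul_mul_assoc r p _

/-- The multilinear operator `∑ p_{I_1,…,I_n} (d/dx_1)^{I_1} ⋯ (d/dx_n)^{I_n}` attached to a polynomial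
`∑ p_{I_1,…,I_n} ξ_1^{I_1} ⋯ ξ_n^{I_n}`. -/
noncomputable def horOp {N n : ℕ} : HorPoly N n →ₗ[ℝ] MultiOp N n :=
  coeffwise mulMon

theorem horOp_monomial {N n : ℕ} (m : Fin n × Fin N →₀ ℕ) (p : Loc N) (g : Fin n → Loc N) :
    horOp (MvPolynomial.monomial m p) g = p * ∏ j, totDPow (m.curry j) (g j) := by
  rw [horOp, coeffwise_monomial, ← horMon_apply]
  rfl

/-- The part of an operator with the vertical derivatives `(∂/∂u_1)^{α_1} ⋯ (∂/∂u_n)^{α_n}`. -/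
noncomputable def vertOp {N n : ℕ} (α : VIdx N n) :
    HorPoly N n →ₗ[ℝ] MultiOp N n where
  toFun P := (horOp P).compLinearMap fun j => pdUPow (α j)
  map_add' P Q := by rw [map_add]; rfl
  map_smul' r P := by rw [map_smul]; rfl

theorem vertOp_apply {N n : ℕ} (α : VIdx N n) (P : HorPoly N n) (f : Fin n → Loc N) :
    vertOp α P f = horOp P fun j => pdUPow (α j) (f j) := rfl

theorem exists_pdUPow_eq_zero {N : ℕ} (f : Loc N) :
    ∃ m, ∀ α : MIdx N →₀ ℕ, m < formalDeg α → pdUPow α f = 0 := by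
  obtain ⟨S, hS⟩ := f.exists_dependsOn
  refine ⟨S.sup Finsupp.degree, fun α hα => ?_⟩
  by_contra h
  refine hα.not_ge (Finset.sup_mono fun J hJ => ?_)
  by_contra hJS
  exact h (pdUPow_eq_zero α (Finsupp.mem_support_iff.1 hJ) (pdU_eq_zero hS hJS))

theorem exists_formalDeg_le {N n : ℕ} (f : Fin n → Loc N) :
    ∃ m, ∀ (α : VIdx N n) (P : HorPoly N n), vertOp α P f ≠ 0 → ∑ j, formalDeg (α j) ≤ m := by
  choose m hm using fun j => exists_pdUPow_eq_zero (f j)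
  refine ⟨∑ j, m j, fun α P h => Finset.sum_le_sum fun j _ => ?_⟩
  by_contra hj
  exact h (MultilinearMap.map_coord_zero (horOp P) j (hm j _ (not_le.1 hj)))

theorem finite_vertOp {N n : ℕ} {X : Type*} (τ : X → VIdx N n) (a : X → HorPoly N n)
    (ha : ∀ m : ℕ, {x | ∑ j, formalDeg (τ x j) ≤ m ∧ a x ≠ 0}.Finite) (f : Fin n → Loc N) :
    (Function.support fun x => vertOp (τ x) (a x) f).Finite := by
  obtain ⟨m, hm⟩ := exists_formalDeg_le f
  refine (ha m).subset fun x hx => ⟨hm _ _ hx, fun h => hx ?_⟩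
  simp [h]

/-- The multilinear operator with a given total symbol. -/
noncomputable def op {N n : ℕ} :
    Symb N n →ₗ[ℝ] MultiOp N n where
  toFun c :=
    { toFun := fun f => ∑ᶠ α, vertOp α ((c : VIdx N n → HorPoly N n) α) f
      map_update_add' := fun f i x y => by
        simp only [MultilinearMap.map_update_add]
        exact finsum_add_distrib (finite_vertOp _ _ c.2 _) (finite_vertOp _ _ c.2 _)
      map_update_smul' := fun f i r x => by
        simp only [MultilinearMap.map_update_smul, smul_finsum] }
  map_add' c d := by
    ext1 f
    refine Eq.trans (finsum_congr fun α => ?_)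
      (finsum_add_distrib (finite_vertOp _ _ c.2 f) (finite_vertOp _ _ d.2 f))
    simp
  map_smul' r c := by
    ext1 f
    simp only [MultilinearMap.coe_mk, RingHom.id_apply, _root_.smul_apply, smul_finsum]
    refine finsum_congr fun α => ?_
    simp

theorem op_apply {N n : ℕ} (c : Symb N n) (f : Fin n → Loc N) :
    op c f = ∑ᶠ α, vertOp α ((c : VIdx N n → HorPoly N n) α) f := rfl

/-- The subspace of all `n`-multilinear local differential operators. -/
noncomputable def ldoSubmodule (N n : ℕ) : Submodule ℝ (MultiOp N n) :=
  LinearMap.range op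

/-- The vector space `LDO(n)` of `n`-multilinear local differential operators. -/
def LDO (N n : ℕ) : Type := ldoSubmodule N n

noncomputable instance (N n : ℕ) : AddCommGroup (LDO N n) :=
  inferInstanceAs (AddCommGroup (ldoSubmodule N n))

noncomputable instance (N n : ℕ) : Module ℝ (LDO N n) :=
  inferInstanceAs (Module ℝ (ldoSubmodule N n))

theorem mem_ldo_of_family {N n : ℕ} {X : Type*} (τ : X → VIdx N n) (a : X → HorPoly N n)
    (ha : ∀ m : ℕ, {x | ∑ j, formalDeg (τ x j) ≤ m ∧ a x ≠ 0}.Finite)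
    (A : MultiOp N n)
    (hA : ∀ f, A f = ∑ᶠ x, vertOp (τ x) (a x) f) : A ∈ ldoSubmodule N n := by
  classical
  have hfin : ∀ α, {x | τ x = α ∧ a x ≠ 0}.Finite := fun α =>
    (ha (∑ j, formalDeg (α j))).subset fun x hx => ⟨by rw [hx.1], hx.2⟩
  let c : VIdx N n → HorPoly N n := fun α => ∑ x ∈ (hfin α).toFinset, a x
  have hc : c ∈ Symb N n := by
    intro m
    refine ((ha m).image τ).subset fun α hα => ?_
    obtain ⟨x, hx, hx'⟩ := Finset.exists_ne_zero_of_sum_ne_zero hα.2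
    have := (hfin α).mem_toFinset.1 hx
    exact ⟨x, ⟨by rw [this.1]; exact hα.1, hx'⟩, this.1⟩
  refine ⟨⟨c, hc⟩, MultilinearMap.ext fun f => ?_⟩
  rw [hA, op_apply]
  have hF := finite_vertOp τ a ha f
  rw [finsum_eq_sum_of_support_subset (s := hF.toFinset) _ (by simp),
    finsum_eq_sum_of_support_subset (s := hF.toFinset.image τ),
    ← Finset.sum_fiberwise_of_maps_to (t := hF.toFinset.image τ) (g := τ)
      (fun x hx => Finset.mem_image_of_mem _ hx)]
  · refine Finset.sum_congr rfl fun α _ => ?_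
    change vertOp α (∑ x ∈ (hfin α).toFinset, a x) f = _
    rw [map_sum, _root_.sum_apply]
    symm
    refine Finset.sum_subset_zero_on_sdiff (fun x hx => ?_) (fun x hx => ?_) fun x hx => ?_
    · rw [Finset.mem_filter, Set.Finite.mem_toFinset] at hx
      exact (hfin α).mem_toFinset.2 ⟨hx.2, fun h => hx.1 (by simp [h])⟩
    · rw [Finset.mem_sdiff, Finset.mem_filter, Set.Finite.mem_toFinset, Set.Finite.mem_toFinset] at hx
      by_contra h
      refine hx.2 ⟨?_, hx.1.1⟩
      rw [Function.mem_support, hx.1.1]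
      exact h
    · rw [(Finset.mem_filter.1 hx).2]
  · intro α hα
    rw [Function.mem_support] at hα
    change vertOp α (∑ x ∈ (hfin α).toFinset, a x) f ≠ 0 at hα
    rw [map_sum, _root_.sum_apply] at hα
    obtain ⟨x, hx, hx'⟩ := Finset.exists_ne_zero_of_sum_ne_zero hα
    have h1 := ((hfin α).mem_toFinset.1 hx).1
    refine Finset.mem_coe.2 (Finset.mem_image.2 ⟨x, ?_, h1⟩)
    rw [Set.Finite.mem_toFinset, Function.mem_support, h1]
    exact hx'

theorem horOp_X_mul {N n : ℕ} (j : Fin n) (i : Fin N) (P : HorPoly N n) (g : Fin n → Loc N) :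
    horOp (MvPolynomial.X (j, i) * P) g = horOp P (Function.update g j (totD i (g j))) := by
  induction P using MvPolynomial.induction_on' with
  | monomial m r =>
    rw [MvPolynomial.X, MvPolynomial.monomial_mul, one_mul, horOp_monomial, horOp_monomial]
    congr 1
    refine Finset.prod_congr rfl fun l _ => ?_
    rw [add_comm]
    by_cases h : l = j
    · subst h
      rw [Function.update_self, ← totDPow_add_single]
      congr 2
      ext k
      simp [Finsupp.curry_apply, Finsupp.single_apply]
    · rw [Function.update_of_ne h]
      congr 2
      ext k
      simp [Finsupp.curry_apply, Ne.symm h]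
  | add P Q hP hQ => simp only [mul_add, map_add, _root_.add_apply, hP, hQ]

theorem totD_prod {N : ℕ} {ι : Type*} [DecidableEq ι] (i : Fin N) (s : Finset ι) (g : ι → Loc N) :
    totD i (∏ j ∈ s, g j) = ∑ j ∈ s, ∏ l ∈ s, Function.update g j (totD i (g j)) l := by
  induction s using Finset.induction_on with
  | empty => simp
  | insert a s ha ih =>
    rw [Finset.prod_insert ha, Derivation.leibniz, ih, Finset.sum_insert ha, Finset.prod_insert ha,
      Function.update_self, Finset.prod_update_of_notMem ha, add_comm, smul_eq_mul, smul_eq_mul,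
      mul_comm (totD i (g a)), Finset.mul_sum]
    congr 1
    refine Finset.sum_congr rfl fun j hj => ?_
    rw [Finset.prod_insert ha, Function.update_of_ne (by rintro rfl; exact ha hj)]

/-- Applies `d/dx^i` to the coefficients of a polynomial. -/
noncomputable def coeffD {N n : ℕ} (i : Fin N) : HorPoly N n →ₗ[ℝ] HorPoly N n :=
  coeffwise fun m => ((MvPolynomial.monomial m).restrictScalars ℝ) ∘ₗ totDEnd i

theorem totD_horOp {N n : ℕ} (i : Fin N) (P : HorPoly N n) (g : Fin n → Loc N) :
    totD i (horOp P g) = horOp (coeffD i P) g +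
      ∑ j, horOp P (Function.update g j (totD i (g j))) := by
  induction P using MvPolynomial.induction_on' with
  | monomial m r =>
    rw [coeffD, coeffwise_monomial, LinearMap.comp_apply, LinearMap.restrictScalars_apply]
    simp only [horOp_monomial]
    rw [Derivation.leibniz, totD_prod, smul_eq_mul, smul_eq_mul, add_comm, mul_comm, Finset.mul_sum]
    congr 1
    refine Finset.sum_congr rfl fun j _ => ?_
    congr 1
    refine Finset.prod_congr rfl fun l _ => ?_
    by_cases h : l = j
    · subst h
      rw [Function.update_self, Function.update_self, ← totDPow_add_single, totDPow_add_single']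
    · rw [Function.update_of_ne h, Function.update_of_ne h]
  | add P Q hP hQ =>
    simp only [map_add, _root_.add_apply, hP, hQ, Finset.sum_add_distrib]
    abel

/-- Post-composition `d/dx^i ∘ A`. -/
noncomputable def leftD {N n : ℕ} (i : Fin N) :
    MultiOp N n →ₗ[ℝ]
      MultiOp N n where
  toFun A := (totDEnd i).compMultilinearMap A
  map_add' A B := by ext1 f; exact map_add (totDEnd i) _ _
  map_smul' r A := by ext1 f; exact map_smul (totDEnd i) _ _

/-- Pre-composition `A ∘ d/dx^i_j` with `d/dx^i` in the `j`-th argument. -/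
noncomputable def rightD {N n : ℕ} (i : Fin N) (j : Fin n) :
    MultiOp N n →ₗ[ℝ]
      MultiOp N n :=
  MultilinearMap.compLinearMapₗ (Function.update (fun _ => LinearMap.id) j (totDEnd i))

theorem rightD_apply {N n : ℕ} (i : Fin N) (j : Fin n)
    (A : MultiOp N n) (f : Fin n → Loc N) :
    rightD i j A f = A (Function.update f j (totD i (f j))) := by
  rw [rightD, MultilinearMap.compLinearMapₗ_apply, MultilinearMap.compLinearMap_apply]
  congr 1
  funext l
  by_cases h : l = j
  · subst h; simp [totDEnd]
  · simp [h]

theorem leftD_mem {N n : ℕ} (i : Fin N) {A : MultiOp N n}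
    (hA : A ∈ ldoSubmodule N n) : leftD i A ∈ ldoSubmodule N n := by
  obtain ⟨c, rfl⟩ := hA
  refine mem_ldo_of_family id (fun α => coeffD i ((c : VIdx N n → HorPoly N n) α) +
    ∑ j, MvPolynomial.X (j, i) * (c : VIdx N n → HorPoly N n) α) (fun m => (c.2 m).subset
      fun α hα => ⟨hα.1, fun h => hα.2 (by simp [h])⟩) _ fun f => ?_
  change totDEnd i (op c f) = _
  rw [op_apply, show ∀ x, totDEnd i x = (totDEnd i).toAddMonoidHom x from fun _ => rfl,
    AddMonoidHom.map_finsum _ (finite_vertOp _ _ c.2 f)]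
  refine finsum_congr fun α => ?_
  rw [map_add, map_sum, _root_.add_apply, _root_.sum_apply]
  simp only [vertOp_apply, horOp_X_mul]
  exact totD_horOp i _ _

theorem le_formalDeg {N : ℕ} {α : MIdx N →₀ ℕ} {J : MIdx N} (hJ : α J ≠ 0) :
    J.degree ≤ formalDeg α :=
  Finset.le_sup (f := Finsupp.degree) (Finsupp.mem_support_iff.2 hJ)

theorem formalDeg_le_add_one {N : ℕ} (α : MIdx N →₀ ℕ) (J : MIdx N) (i : Fin N) :
    formalDeg α ≤ formalDeg (α - Finsupp.single J 1 +
      Finsupp.single (J - Finsupp.single i 1) 1) + 1 := by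
  classical
  refine Finset.sup_le fun K hK => ?_
  rw [Finsupp.mem_support_iff] at hK
  by_cases h : K = J
  · subst h
    have h1 := le_formalDeg (α := α - Finsupp.single K 1 + Finsupp.single (K - Finsupp.single i 1) 1)
      (J := K - Finsupp.single i 1) (by simp)
    have h2 : K.degree ≤ (K - Finsupp.single i 1 + Finsupp.single i 1).degree :=
      Finsupp.degree_mono le_tsub_add
    rw [map_add, Finsupp.degree_single] at h2
    omega
  · refine (le_formalDeg (J := K) ?_).trans (Nat.le_succ _)
    simp [Finsupp.single_apply, Ne.symm h, hK]

theorem rightD_mem {N n : ℕ} (i : Fin N) (j : Fin n)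
    {A : MultiOp N n}
    (hA : A ∈ ldoSubmodule N n) : rightD i j A ∈ ldoSubmodule N n := by
  classical
  obtain ⟨c, rfl⟩ := hA
  have h1 : ∀ m : ℕ, {α : VIdx N n | ∑ l, formalDeg (α l) ≤ m ∧
      MvPolynomial.X (j, i) * (c : VIdx N n → HorPoly N n) α ≠ 0}.Finite := fun m =>
    (c.2 m).subset fun α hα => ⟨hα.1, fun h => hα.2 (by simp [h])⟩
  let τ : VIdx N n × MIdx N → VIdx N n := fun x => Function.update x.1 j
    (x.1 j - Finsupp.single x.2 1 + Finsupp.single (x.2 - Finsupp.single i 1) 1)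
  let a : VIdx N n × MIdx N → HorPoly N n := fun x =>
    (x.1 j x.2) • if x.2 i = 0 then 0 else (c : VIdx N n → HorPoly N n) x.1
  have h2 : ∀ m : ℕ, {x | ∑ l, formalDeg (τ x l) ≤ m ∧ a x ≠ 0}.Finite := by
    intro m
    refine (((c.2 (m + 1)).toFinset.sigma fun α => (α j).support).finite_toSet.image
      fun x => (x.1, x.2)).subset ?_
    rintro ⟨α, J⟩ ⟨hx, hx'⟩
    have hc : (c : VIdx N n → HorPoly N n) α ≠ 0 := fun h => hx' (by simp [a, h])
    have hJ : α j J ≠ 0 := fun h => hx' (by simp [a, h])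
    refine ⟨⟨α, J⟩, ?_, rfl⟩
    rw [Finset.mem_coe, Finset.mem_sigma, Set.Finite.mem_toFinset]
    refine ⟨⟨?_, hc⟩, Finsupp.mem_support_iff.2 hJ⟩
    refine le_trans ?_ (Nat.add_le_add_right hx 1)
    rw [← Finset.add_sum_erase _ _ (Finset.mem_univ j), ← Finset.add_sum_erase (a := j) _ (fun l => formalDeg (τ (α, J) l)) (Finset.mem_univ j),
      Finset.sum_congr (g := fun l => formalDeg (τ (α, J) l)) (s₁ := Finset.univ.erase j) rfl
        fun l hl => by simp only [τ]; rw [Function.update_of_ne (Finset.ne_of_mem_erase hl)]]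
    have := formalDeg_le_add_one (α j) J i
    simp only [τ, Function.update_self] at *
    omega
  have hA1 := finite_vertOp id _ h1
  have hA2 := finite_vertOp τ a h2
  let A1 : Symb N n := ⟨_, h1⟩
  have hmem : rightD i j (op c) - op A1 ∈ ldoSubmodule N n := by
    refine mem_ldo_of_family τ a h2 _ fun f => ?_
    rw [_root_.sub_apply, sub_eq_iff_eq_add, rightD_apply, op_apply, op_apply,
      finsum_curry _ (hA2 f)]
    refine Eq.trans ?_ (finsum_add_distrib ?_ (hA1 f))
    · refine finsum_congr fun α => ?_
      rw [finsum_eq_sum_of_support_subset (s := (α j).support)]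
      · set v : Fin n → Loc N := fun l => pdUPow (α l) (f l) with hv
        set P := (c : VIdx N n → HorPoly N n) α with hP
        have e1 : (fun l => pdUPow (α l) (Function.update f j (totD i (f j)) l)) =
            Function.update v j (pdUPow (α j) (totD i (f j))) := by
          funext l
          by_cases h : l = j
          · subst h; simp
          · simp [h, hv]
        rw [vertOp_apply, e1, pdUPow_totD, MultilinearMap.map_update_add, add_comm]
        congr 1
        · rw [Finsupp.sum, MultilinearMap.map_update_sum]
          refine Finset.sum_congr rfl fun J _ => ?_
          have e2 : (fun l => pdUPow (τ (α, J) l) (f l)) = Function.update v j (pdUPow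
              (α j - Finsupp.single J 1 + Finsupp.single (J - Finsupp.single i 1) 1) (f j)) := by
            funext l
            by_cases h : l = j
            · subst h; simp [τ]
            · simp [h, hv, τ]
          rw [vertOp_apply, e2]
          simp only [a]
          rw [map_nsmul, _root_.smul_apply, ← Nat.cast_smul_eq_nsmul ℝ (α j J),
            ← Nat.cast_smul_eq_nsmul ℝ (α j J), MultilinearMap.map_update_smul]
          split_ifs
          · simp
          · rfl
        · rw [vertOp_apply]
          exact (horOp_X_mul j i P v).symm
      · intro J hJ
        by_contra h
        refine hJ ?_
        have : α j J = 0 := by simpa using h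
        simp [a, this]
    · refine Set.Finite.subset ((hA2 f).image Prod.fst) fun α hα => ?_
      by_contra h
      refine hα ((finsum_congr fun J => ?_).trans finsum_zero)
      by_contra hJ
      exact h ⟨(α, J), hJ, rfl⟩
  have := (ldoSubmodule N n).add_mem hmem (⟨A1, rfl⟩ : op A1 ∈ ldoSubmodule N n)
  exact (sub_add_cancel (rightD i j (op c)) (op A1)) ▸ this

/-- The commutator of a product of commuting operators with a multiplication operator. -/
theorem opPow_mul_left {ι A : Type*} [DecidableEq ι] [CommRing A] [Algebra ℝ A]
    (T : ι → Module.End ℝ A) (hT : ∀ i k, Commute (T i) (T k)) (y : ι → A)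
    (hy : ∀ k i h, T k (y i * h) = y i * T k h + if k = i then h else 0)
    (i : ι) (α : ι →₀ ℕ) (h : A) :
    opPow T hT α (y i * h) =
      y i * opPow T hT α h + α i • opPow T hT (α - Finsupp.single i 1) h := by
  induction α using finsupp_nat_induction generalizing h with
  | h0 => simp [opPow_zero]
  | h1 α k ih =>
    have key : ∀ g, opPow T hT (α + Finsupp.single k 1) g = opPow T hT α (T k g) := fun g => by
      rw [opPow_add, opPow_single]; rfl
    rw [key, key, hy, map_add, ih, add_assoc]
    congr 1
    by_cases hk : k = i
    · subst hk
      rw [if_pos rfl, Finsupp.add_apply, Finsupp.single_eq_same, add_smul, one_smul,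
        add_tsub_cancel_right]
      congr 1
      by_cases h0 : α k = 0
      · simp [h0]
      · congr 1
        have : α = α - Finsupp.single k 1 + Finsupp.single k 1 :=
          (tsub_add_cancel_of_le (by
            simpa [Finsupp.single_le_iff] using Nat.one_le_iff_ne_zero.2 h0)).symm
        conv_rhs => rw [this]
        rw [opPow_add, opPow_single]
        rfl
    · rw [if_neg hk, map_zero, add_zero, Finsupp.add_apply, Finsupp.single_eq_of_ne (Ne.symm hk), add_zero]
      by_cases h0 : α i = 0
      · simp [h0]
      · congr 1
        have : α + Finsupp.single k 1 - Finsupp.single i 1 =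
            α - Finsupp.single i 1 + Finsupp.single k 1 :=
          (tsub_add_eq_add_tsub (by
            simpa [Finsupp.single_le_iff] using Nat.one_le_iff_ne_zero.2 h0)).symm
        rw [this, opPow_add, opPow_single]
        rfl

theorem opPow_test {ι A : Type*} [DecidableEq ι] [CommRing A] [Algebra ℝ A]
    (T : ι → Module.End ℝ A) (hT : ∀ i k, Commute (T i) (T k)) (y : ι → A)
    (hy : ∀ k i h, T k (y i * h) = y i * T k h + if k = i then h else 0)
    (ε : A →ₐ[ℝ] ℝ) (hε : ∀ i, ε (y i) = 0) (β : ι →₀ ℕ) :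
    ∀ (α : ι →₀ ℕ) (h : A),
      (¬ β ≤ α → ε (opPow T hT α (β.prod (fun i k => y i ^ k) * h)) = 0) ∧
      (β ≤ α → ∃ c : ℝ, c ≠ 0 ∧ ε (opPow T hT α (β.prod (fun i k => y i ^ k) * h)) =
        c * ε (opPow T hT (α - β) h)) := by
  induction β using finsupp_nat_induction with
  | h0 => intro α h; exact ⟨fun h0 => absurd (zero_le (a := α)) h0, fun _ => ⟨1, one_ne_zero, by simp⟩⟩
  | h1 β i ih =>
    intro α h
    have key : ε (opPow T hT α ((β + Finsupp.single i 1).prod (fun i k => y i ^ k) * h)) =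
        α i * ε (opPow T hT (α - Finsupp.single i 1) (β.prod (fun i k => y i ^ k) * h)) := by
      rw [Finsupp.prod_add_index' (by simp) (by simp [pow_add]), Finsupp.prod_single_index (by simp),
        pow_one, mul_comm (β.prod _) (y i), mul_assoc, opPow_mul_left T hT y hy, map_add, map_mul, hε,
        zero_mul, zero_add, map_nsmul, nsmul_eq_mul]
    by_cases h0 : α i = 0
    · refine ⟨fun _ => by rw [key, h0]; simp, fun hle => ?_⟩
      have := hle i
      simp [h0] at this
    · have h1 : Finsupp.single i 1 ≤ α := by
        simpa [Finsupp.single_le_iff] using Nat.one_le_iff_ne_zero.2 h0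
      have h2 : β + Finsupp.single i 1 ≤ α ↔ β ≤ α - Finsupp.single i 1 :=
        (le_tsub_iff_right h1).symm
      rw [h2, key]
      refine ⟨fun hn => by rw [(ih _ _).1 hn, mul_zero], fun hle => ?_⟩
      obtain ⟨c, hc, hc'⟩ := (ih (α - Finsupp.single i 1) h).2 hle
      refine ⟨α i * c, mul_ne_zero (Nat.cast_ne_zero.2 h0) hc, ?_⟩
      rw [hc', tsub_tsub, add_comm (Finsupp.single i 1), mul_assoc]

/-- Evaluation of local functions at a point. -/
def evalAt {N : ℕ} (z : Jet N) : Loc N →ₐ[ℝ] ℝ :=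
  (Pi.evalAlgHom ℝ (fun _ => ℝ) z).comp (locSubalgebra N).val

theorem derivation_prod_eq_zero {N : ℕ} {ι : Type*} (d : Derivation ℝ (Loc N) (Loc N))
    (β : ι →₀ ℕ) (y : ι → Loc N) (h : ∀ i ∈ β.support, d (y i) = 0) :
    d (β.prod fun i k => y i ^ k) = 0 := by
  refine Finset.prod_induction _ (fun p => d p = 0) (fun a b ha hb => ?_) (by simp) fun i hi => ?_
  · simp [ha, hb]
  · simp [h i hi]

theorem pdUPow_mul_left {N : ℕ} (α : MIdx N →₀ ℕ) (y w : Loc N) (hy : ∀ J, pdU J y = 0) :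
    pdUPow α (y * w) = y * pdUPow α w := by
  induction α using finsupp_nat_induction generalizing w with
  | h0 => simp [pdUPow_zero]
  | h1 α J ih =>
    rw [pdUPow_add_single, pdUPow_add_single, ← ih, Derivation.leibniz, hy]
    simp

theorem horOp_apply {N n : ℕ} (P : HorPoly N n) (g : Fin n → Loc N) :
    horOp P g = ∑ m ∈ P.support, P.coeff m * ∏ j, totDPow (m.curry j) (g j) := by
  simp only [← horMon_apply]
  change (∑ m ∈ P.support, mulMon m (P.coeff m)) g = _
  rw [_root_.sum_apply]
  rfl

/-- The total symbol is uniquely determined by the operator. -/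
theorem op_injective {N n : ℕ} : Function.Injective (op (N := N) (n := n)) := by
  classical
  rw [injective_iff_map_eq_zero]
  intro c hc
  by_contra hne
  set C : VIdx N n → HorPoly N n := c.1 with hC
  obtain ⟨α₀, hα₀⟩ : ∃ α, C α ≠ 0 := by
    by_contra h
    push Not at h
    exact hne (Subtype.ext (funext h))
  set F := (c.2 (∑ j, formalDeg (α₀ j))).toFinset with hF
  have hα₀F : α₀ ∈ F := (Set.Finite.mem_toFinset _).2 ⟨le_rfl, hα₀⟩
  obtain ⟨β, hβF, hβ⟩ := Finset.exists_max_image F (fun α => (C α).totalDegree) ⟨α₀, hα₀F⟩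
  obtain ⟨hβm, hβ0⟩ := (Set.Finite.mem_toFinset _).1 hβF
  obtain ⟨K, hK, hKd⟩ : ∃ K ∈ (C β).support, (C β).totalDegree = K.degree := by
    obtain ⟨K, hK, h⟩ := Finset.exists_mem_eq_sup (C β).support
      (MvPolynomial.support_nonempty.2 hβ0) (fun s => s.sum fun _ e => e)
    exact ⟨K, hK, h⟩
  obtain ⟨z, hz⟩ : ∃ z, evalAt z ((C β).coeff K) ≠ 0 := by
    by_contra h
    push Not at h
    exact MvPolynomial.mem_support_iff.1 hK (Subtype.ext (funext h))
  let y : Fin N → Loc N := fun i => xCoord i - algebraMap ℝ _ (z.1 i)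
  let v : MIdx N → Loc N := fun J => uCoord J - algebraMap ℝ _ (z.2 J)
  have hy : ∀ k i h, totDEnd k (y i * h) = y i * totDEnd k h + if k = i then h else 0 := by
    intro k i h
    change totD k (y i * h) = y i * totD k h + _
    have : totD k (y i) = if i = k then 1 else 0 := by simp [y, totD_xCoord]
    rw [Derivation.leibniz, this]
    by_cases hk : i = k <;> simp [hk, Ne.symm]
  have hv : ∀ K J h, pdUEnd K (v J * h) = v J * pdUEnd K h + if K = J then h else 0 := by
    intro K J h
    change pdU K (v J * h) = v J * pdU K h + _
    have : pdU K (v J) = if J = K then 1 else 0 := by simp [v, pdU_uCoord]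
    rw [Derivation.leibniz, this]
    by_cases hk : J = K <;> simp [hk, Ne.symm]
  have hεy : ∀ i, evalAt z (y i) = 0 := fun i => by
    simp only [y, map_sub, AlgHom.commutes]; exact sub_self (z.1 i)
  have hεv : ∀ J, evalAt z (v J) = 0 := fun J => by
    simp only [v, map_sub, AlgHom.commutes]; exact sub_self (z.2 J)
  let X : Fin n → Loc N := fun j => (K.curry j).prod fun i k => y i ^ k
  let V : Fin n → Loc N := fun j => (β j).prod fun J k => v J ^ k
  let f : Fin n → Loc N := fun j => X j * V j
  have hX : ∀ j J, pdU J (X j) = 0 := fun j J =>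
    derivation_prod_eq_zero _ _ _ fun i _ => by simp [y, pdU_xCoord]
  have hf : ∀ (α : VIdx N n) j, pdUPow (α j) (f j) = X j * pdUPow (α j) (V j) := fun α j =>
    pdUPow_mul_left _ _ _ (hX j)
  -- the value of one term at `z`
  have hzero : ∀ (α : VIdx N n) m (j : Fin n), ¬ K.curry j ≤ m →
      evalAt z (totDPow m (pdUPow (α j) (f j))) = 0 := fun α m j h => by
    rw [hf]
    exact (opPow_test totDEnd commute_totDEnd y hy (evalAt z) hεy _ _ _).1 h
  have hself : ∀ (α : VIdx N n) (j : Fin n), ∃ r : ℝ, r ≠ 0 ∧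
      evalAt z (totDPow (K.curry j) (pdUPow (α j) (f j))) =
        r * evalAt z (pdUPow (α j) (V j)) := fun α j => by
    obtain ⟨r, hr, h⟩ := (opPow_test totDEnd commute_totDEnd y hy (evalAt z) hεy (K.curry j)
      (K.curry j) (pdUPow (α j) (V j))).2 le_rfl
    refine ⟨r, hr, ?_⟩
    rw [hf]
    refine h.trans ?_
    rw [tsub_self, opPow_zero]
    rfl
  have hVne : ∀ (α : VIdx N n) j, α j ≠ β j → evalAt z (pdUPow (α j) (V j)) = 0 := by
    intro α j hj
    have := opPow_test pdUEnd commute_pdUEnd v hv (evalAt z) hεv (β j) (α j) 1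
    rw [mul_one] at this
    by_cases hle : β j ≤ α j
    · obtain ⟨r, -, h⟩ := this.2 hle
      refine h.trans ?_
      obtain ⟨J, hJ⟩ : ∃ J, (α j - β j) J ≠ 0 := by
        by_contra h0
        push Not at h0
        refine hj (le_antisymm ?_ hle)
        rw [← tsub_eq_zero_iff_le]
        exact Finsupp.ext h0
      have h1 : pdUPow (α j - β j) (1 : Loc N) = 0 := pdUPow_eq_zero _ hJ (by simp)
      have h2 : opPow pdUEnd commute_pdUEnd (α j - β j) (1 : Loc N) = 0 := h1
      rw [h2, map_zero, mul_zero]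
    · exact this.1 hle
  have hVself : ∀ j, evalAt z (pdUPow (β j) (V j)) ≠ 0 := by
    intro j
    obtain ⟨r, hr, h⟩ := (opPow_test pdUEnd commute_pdUEnd v hv (evalAt z) hεv (β j) (β j) 1).2 le_rfl
    rw [mul_one, tsub_self, opPow_zero] at h
    refine ne_of_eq_of_ne h ?_
    simpa using hr
  have hterm : ∀ α, (C α = 0 ∨ (C α).totalDegree ≤ K.degree) →
      evalAt z (vertOp α (C α) f) =
        evalAt z ((C α).coeff K) * ∏ j, evalAt z (totDPow (K.curry j) (pdUPow (α j) (f j))) := by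
    intro α hα
    rw [vertOp_apply, horOp_apply, map_sum, Finset.sum_eq_single K, map_mul, map_prod]
    · intro m hm hmK
      rw [map_mul, map_prod]
      have hd : m.degree ≤ K.degree := by
        rcases hα with h | h
        · simp [h] at hm
        · exact (MvPolynomial.le_totalDegree hm).trans h
      obtain ⟨j, hj⟩ : ∃ j, ¬ K.curry j ≤ m.curry j := by
        by_contra hall
        push Not at hall
        have hle : K ≤ m := fun p => by simpa [Finsupp.curry_apply] using hall p.1 p.2
        have : m = K + (m - K) := (add_tsub_cancel_of_le hle).symm
        rw [this, map_add] at hd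
        have h0 : (m - K).degree = 0 := by omega
        rw [(Finsupp.degree_eq_zero_iff _).1 h0, add_zero] at this
        exact hmK this
      rw [Finset.prod_eq_zero (Finset.mem_univ j) (hzero α _ j hj), mul_zero]
    · intro hm
      rw [MvPolynomial.notMem_support_iff.1 hm, zero_mul, map_zero]
  have hmain : evalAt z (op c f) = evalAt z (vertOp β (C β) f) := by
    rw [op_apply, show evalAt z (∑ᶠ α, vertOp α (C α) f) = ∑ᶠ α, evalAt z (vertOp α (C α) f) from
      AddMonoidHom.map_finsum (evalAt z : Loc N →+ ℝ) (finite_vertOp _ _ c.2 f)]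
    refine finsum_eq_single _ β fun α hαβ => ?_
    by_cases hdeg : ∀ j, formalDeg (α j) ≤ formalDeg (β j)
    · have hC' : C α = 0 ∨ (C α).totalDegree ≤ K.degree := by
        by_cases h0 : C α = 0
        · exact Or.inl h0
        · right
          rw [← hKd]
          exact hβ α ((Set.Finite.mem_toFinset _).2
            ⟨(Finset.sum_le_sum fun j _ => hdeg j).trans hβm, h0⟩)
      rw [hterm α hC']
      obtain ⟨j, hj⟩ := Function.ne_iff.1 hαβ
      obtain ⟨r, -, hr⟩ := hself α j
      rw [Finset.prod_eq_zero (Finset.mem_univ j) (by rw [hr, hVne α j hj, mul_zero]), mul_zero]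
    · push Not at hdeg
      obtain ⟨j, hj⟩ := hdeg
      obtain ⟨J, hJα, hJβ⟩ : ∃ J, α j J ≠ 0 ∧ β j J = 0 := by
        by_contra hall
        push Not at hall
        refine hj.not_ge (Finset.sup_mono fun J hJ => ?_)
        rw [Finsupp.mem_support_iff] at hJ ⊢
        exact hall J hJ
      have h0 : pdUPow (α j) (f j) = 0 := by
        rw [hf, pdUPow_eq_zero _ hJα, mul_zero]
        refine derivation_prod_eq_zero _ _ _ fun L hL => ?_
        have : L ≠ J := by rintro rfl; exact Finsupp.mem_support_iff.1 hL hJβ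
        simp [v, pdU_uCoord, this]
      rw [vertOp_apply, MultilinearMap.map_coord_zero _ j h0, map_zero]
  rw [hc, hterm β (Or.inr hKd.le)] at hmain
  simp only [_root_.zero_apply, map_zero] at hmain
  refine mul_ne_zero hz (Finset.prod_ne_zero_iff.2 fun j _ => ?_) hmain.symm
  obtain ⟨r, hr, h⟩ := hself β j
  rw [h]
  exact mul_ne_zero hr (hVself j)

/-- An operator in `LDO(n)` amounts to its total symbol. -/
noncomputable def symbolEquiv (N n : ℕ) : Symb N n ≃ₗ[ℝ] LDO N n :=
  LinearEquiv.ofInjective op op_injective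

/-- Rewrites a polynomial in the `d/dx_j` in polarized form, that is, in terms of
`d/dy_1 = d/dx_1 + ⋯ + d/dx_n` and `d/dy_j = d/dx_j` for `j ≥ 2`: it substitutes
`d/dx_1 = d/dy_1 - ∑_{j ≥ 2} d/dy_j`. In the result the variable `(j, i)` stands for `d/dy^i_j`;
the first argument has index `0`. -/
noncomputable def polarize {N n : ℕ} [NeZero n] : HorPoly N n →ₐ[Loc N] HorPoly N n :=
  MvPolynomial.aeval fun p =>
    if p.1 = 0 then MvPolynomial.X p - ∑ j ∈ Finset.univ.erase (0 : Fin n), MvPolynomial.X (j, p.2)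
    else MvPolynomial.X p

/-- The characteristic of a polynomial in polarized form: the term
`q (d/dy_1)^{I_1} (d/dy_2)^{I_2} ⋯ (d/dy_n)^{I_n}` becomes
`(-1)^{|I_1|} ((d/dx)^{I_1} q) (d/dy_2)^{I_2} ⋯ (d/dy_n)^{I_n}`. The result does not involve `d/dy_1`,
and `d/dy_j = d/dx_j` for `j ≥ 2`. -/
noncomputable def charPoly {N n : ℕ} [NeZero n] : HorPoly N n →ₗ[ℝ] HorPoly N n :=
  coeffwise fun m =>
    ((MvPolynomial.monomial (m.filter fun p => p.1 ≠ 0)).restrictScalars ℝ) ∘ₗ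
      ((-1 : ℝ) ^ (m.curry 0).degree • totDPow (m.curry 0))

/-- The characteristic on total symbols. -/
noncomputable def chiSymb {N n : ℕ} [NeZero n] : Symb N n →ₗ[ℝ] Symb N n where
  toFun c := ⟨fun α => charPoly (polarize ((c : VIdx N n → HorPoly N n) α)), fun m =>
    (c.2 m).subset fun α hα => ⟨hα.1, fun h => hα.2 (by simp [h])⟩⟩
  map_add' c d := by ext1; funext α; simp
  map_smul' r c := by
    ext1; funext α
    have h : polarize (r • (c : VIdx N n → HorPoly N n) α) =
      r • polarize ((c : VIdx N n → HorPoly N n) α) := map_smul (polarize.restrictScalars ℝ) r _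
    simp [h]

/-- The characteristic `χ : LDO(n) → LDO(n)`. -/
noncomputable def chi (N n : ℕ) [NeZero n] : LDO N n →ₗ[ℝ] LDO N n :=
  (symbolEquiv N n).toLinearMap ∘ₗ chiSymb ∘ₗ (symbolEquiv N n).symm.toLinearMap

/-- Pre-composition `A ↦ A ∘ d/dx^i_j` on `LDO(n)`. -/
noncomputable def ldoRightD {N n : ℕ} (i : Fin N) (j : Fin n) : LDO N n →ₗ[ℝ] LDO N n where
  toFun A := ⟨rightD i j A.1, rightD_mem i j A.2⟩
  map_add' A B := Subtype.ext (map_add (rightD i j) A.1 B.1)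
  map_smul' r A := Subtype.ext (map_smul (rightD i j) r A.1)

/-- The map `a₀ : LDO(n) → LDO(n)^{⊕Nn}`, `a₀(A)_{i,j} = χ(A ∘ d/dx^i_j)`. -/
noncomputable def aZero (N n : ℕ) [NeZero n] : LDO N n →ₗ[ℝ] (Fin N → Fin n → LDO N n) :=
  LinearMap.pi fun i => LinearMap.pi fun j => chi N n ∘ₗ ldoRightD i j

/-- Horizontal forms on the jet bundle: `w` stands for `∑_ε w_ε (dx)^ε`, where `ε ⊆ {1, …, N}` and
`(dx)^ε` is the wedge product of the `dx^i`, `i ∈ ε`, in increasing order. The form `(dx)^ε` has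
degree `N - |ε|` in the regraded complex `Ω_*`. -/
abbrev Form (N : ℕ) : Type := Finset (Fin N) → Loc N

/-- The horizontal differential `d_H w = ∑_i dx^i ∧ (d/dx^i) w`. Here
`dx^i ∧ (dx)^{δ \ {i}} = (-1)^s (dx)^δ` where `s` is the number of `l ∈ δ` with `l < i`. -/
noncomputable def dH (N : ℕ) : Form N →ₗ[ℝ] Form N :=
  LinearMap.pi fun δ => ∑ i ∈ δ, (-1 : ℝ) ^ (δ.filter (· < i)).card •
    (totDEnd i ∘ₗ LinearMap.proj (δ.erase i))

/-- The grading involution `w ↦ (-1)^{deg w} w` of `Ω_*`. -/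
noncomputable def gradInv (N : ℕ) : Form N →ₗ[ℝ] Form N :=
  LinearMap.pi fun ε => (-1 : ℝ) ^ (N - ε.card) • LinearMap.proj ε

/-- `n`-linear maps from forms to forms, that is, linear maps `Ω_*^{⊗n} → Ω_*`. -/
abbrev FormOp (N n : ℕ) : Type := MultilinearMap ℝ (fun _ : Fin n => Form N) (Form N)

/-- The matrix coefficient `(h_1, …, h_n) ↦` coefficient of `(dx)^δ` in
`f(h_1 (dx)^{ε_1}, …, h_n (dx)^{ε_n})`. -/
noncomputable def matCoeff {N n : ℕ} (ε : Fin n → Finset (Fin N)) (δ : Finset (Fin N)) :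
    FormOp N n →ₗ[ℝ] MultiOp N n where
  toFun f := (LinearMap.proj (R := ℝ) (φ := fun _ : Finset (Fin N) => Loc N) δ).compMultilinearMap
    (f.compLinearMap fun j => LinearMap.single ℝ (fun _ : Finset (Fin N) => Loc N) (ε j))
  map_add' _ _ := rfl
  map_smul' _ _ := rfl

theorem matCoeff_apply {N n : ℕ} (ε : Fin n → Finset (Fin N)) (δ : Finset (Fin N)) (f : FormOp N n)
    (h : Fin n → Loc N) : matCoeff ε δ f h = f (fun j => Pi.single (ε j) (h j)) δ := rfl

/-- The condition that the matrix coefficient at `(ε_1, …, ε_n; δ)` is that of a map of degree `k`: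
`deg (dx)^δ = ∑ deg (dx)^{ε_j} + k`. -/
def DegreeMatch {N n : ℕ} (k : ℤ) (ε : Fin n → Finset (Fin N)) (δ : Finset (Fin N)) : Prop :=
  (N : ℤ) - δ.card = ∑ j, ((N : ℤ) - (ε j).card) + k

/-- The subspace of all maps `Ω_*^{⊗n} → Ω_*` of degree `k` with matrix coefficients in `LDO(n)`. -/
def dEndSubmodule (N n : ℕ) (k : ℤ) : Submodule ℝ (FormOp N n) where
  carrier := {f | ∀ ε δ, matCoeff ε δ f ∈ ldoSubmodule N n ∧
    (¬ DegreeMatch k ε δ → matCoeff ε δ f = 0)}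
  zero_mem' ε δ := by simp
  add_mem' {f g} hf hg ε δ := by
    rw [map_add]
    refine ⟨add_mem (hf ε δ).1 (hg ε δ).1, fun h => ?_⟩
    rw [(hf ε δ).2 h, (hg ε δ).2 h, add_zero]
  smul_mem' r f hf ε δ := by
    rw [map_smul]
    refine ⟨Submodule.smul_mem _ r (hf ε δ).1, fun h => ?_⟩
    rw [(hf ε δ).2 h, smul_zero]

/-- The vector space `DEnd_k(n)`. -/
def DEnd (N n : ℕ) (k : ℤ) : Type := dEndSubmodule N n k

noncomputable instance (N n : ℕ) (k : ℤ) : AddCommGroup (DEnd N n k) :=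
  inferInstanceAs (AddCommGroup (dEndSubmodule N n k))

noncomputable instance (N n : ℕ) (k : ℤ) : Module ℝ (DEnd N n k) :=
  inferInstanceAs (Module ℝ (dEndSubmodule N n k))

/-- The linear maps applied to the arguments in the `j`-th summand of `d_H^{⊗n}`. -/
noncomputable def tensorArg {N n : ℕ} (j l : Fin n) : Form N →ₗ[ℝ] Form N :=
  if l < j then gradInv N else if l = j then dH N else LinearMap.id

/-- `f ↦ f ∘ d_H^{⊗n}`, where `d_H^{⊗n}` is the differential of `Ω_*^{⊗n}`:
`d_H^{⊗n}(w_1 ⊗ ⋯ ⊗ w_n) = ∑_j (-1)^{deg w_1 + ⋯ + deg w_{j-1}} w_1 ⊗ ⋯ ⊗ d_H w_j ⊗ ⋯ ⊗ w_n`. -/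
noncomputable def compTensorD (N n : ℕ) : FormOp N n →ₗ[ℝ] FormOp N n :=
  ∑ j : Fin n, MultilinearMap.compLinearMapₗ (tensorArg j)

/-- `δ f = d_H f - (-1)^k f d_H^{⊗n}` for `f` of degree `k`. -/
noncomputable def preDelta (N n : ℕ) (k : ℤ) : FormOp N n →ₗ[ℝ] FormOp N n where
  toFun f := (dH N).compMultilinearMap f - (-1 : ℝ) ^ k • compTensorD N n f
  map_add' f g := by
    refine MultilinearMap.ext fun w => ?_
    simp only [map_add, _root_.sub_apply, LinearMap.compMultilinearMap_apply, _root_.add_apply,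
      _root_.smul_apply, smul_add]
    abel
  map_smul' r f := by
    refine MultilinearMap.ext fun w => ?_
    simp only [map_smul, _root_.sub_apply, LinearMap.compMultilinearMap_apply, _root_.smul_apply,
      RingHom.id_apply, smul_sub, smul_comm r]

theorem preDelta_apply {N n : ℕ} (k : ℤ) (f : FormOp N n) (w : Fin n → Form N) :
    preDelta N n k f w = dH N (f w) -
      (-1 : ℝ) ^ k • ∑ j, f fun l => tensorArg j l (w l) := by
  change dH N (f w) - (-1 : ℝ) ^ k • compTensorD N n f w = _
  congr 2
  rw [compTensorD, LinearMap.sum_apply, _root_.sum_apply]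
  rfl

theorem dH_apply {N : ℕ} (w : Form N) (δ : Finset (Fin N)) :
    dH N w δ = ∑ i ∈ δ, (-1 : ℝ) ^ (δ.filter (· < i)).card • totD i (w (δ.erase i)) := by
  rw [dH, LinearMap.pi_apply, LinearMap.sum_apply]
  rfl

theorem gradInv_apply {N : ℕ} (w : Form N) (ε : Finset (Fin N)) :
    gradInv N w ε = (-1 : ℝ) ^ (N - ε.card) • w ε := rfl

theorem gradInv_gradInv {N : ℕ} (w : Form N) : gradInv N (gradInv N w) = w := by
  funext ε
  rw [gradInv_apply, gradInv_apply, smul_smul, ← pow_add, Even.neg_one_pow ⟨_, rfl⟩, one_smul]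

theorem gradInv_dH {N : ℕ} (w : Form N) : gradInv N (dH N w) = -dH N (gradInv N w) := by
  funext δ
  rw [Pi.neg_apply, gradInv_apply, dH_apply, dH_apply, Finset.smul_sum, ← Finset.sum_neg_distrib]
  refine Finset.sum_congr rfl fun i hi => ?_
  have hc := Finset.card_erase_add_one hi
  have hN := Finset.card_le_univ δ
  rw [Fintype.card_fin] at hN
  have : N - (δ.erase i).card = N - δ.card + 1 := by omega
  rw [gradInv_apply, this, pow_succ, mul_neg_one, neg_smul, map_neg, smul_neg, neg_neg]
  have h := (totD i).map_smul ((-1 : ℝ) ^ (N - δ.card)) (w (δ.erase i))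
  rw [h, smul_comm]

theorem card_filter_erase {N : ℕ} (δ : Finset (Fin N)) {i k : Fin N} (hi : i ∈ δ)
    (hik : i < k) :
    ((δ.erase k).filter (· < i)).card + (δ.filter (· < k)).card =
      (δ.filter (· < i)).card + ((δ.erase i).filter (· < k)).card + 1 := by
  have h1 : (δ.erase k).filter (· < i) = δ.filter (· < i) := by
    ext l
    simp only [Finset.mem_filter, Finset.mem_erase]
    constructor
    · tauto
    · rintro ⟨h, h'⟩
      exact ⟨⟨(h'.trans hik).ne, h⟩, h'⟩
  have h2 : (δ.erase i).filter (· < k) = (δ.filter (· < k)).erase i := by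
    ext l
    simp only [Finset.mem_filter, Finset.mem_erase]
    tauto
  rw [h1, h2, add_assoc, Finset.card_erase_add_one (Finset.mem_filter.2 ⟨hi, hik⟩)]

theorem sum_eq_zero_of_antisymm {ι M : Type*} [Fintype ι] [AddCommGroup M] [Module ℝ M]
    (T : ι → ι → M) (hT : ∀ i k, T i k = - T k i) : ∑ i, ∑ k, T i k = 0 := by
  have h2 : ∑ i, ∑ k, T i k = -∑ i, ∑ k, T i k := by
    conv_lhs => rw [Finset.sum_comm]
    rw [← Finset.sum_neg_distrib]
    refine Finset.sum_congr rfl fun i _ => ?_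
    rw [← Finset.sum_neg_distrib]
    exact Finset.sum_congr rfl fun k _ => hT k i
  have h3 : (2 : ℝ) • ∑ i, ∑ k, T i k = 0 := by
    rw [two_smul]
    nth_rewrite 1 [h2]
    exact neg_add_cancel _
  exact (smul_eq_zero.1 h3).resolve_left two_ne_zero

theorem dH_dH {N : ℕ} (w : Form N) : dH N (dH N w) = 0 := by
  funext δ
  rw [Pi.zero_apply, dH_apply]
  let T : Fin N → Fin N → Loc N := fun i k => if i ∈ δ ∧ k ∈ δ ∧ k ≠ i then
    (-1 : ℝ) ^ ((δ.filter (· < i)).card + ((δ.erase i).filter (· < k)).card) •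
      totD i (totD k (w ((δ.erase i).erase k))) else 0
  have hT : ∀ i k, T i k = - T k i := by
    intro i k
    by_cases h : i ∈ δ ∧ k ∈ δ ∧ k ≠ i
    · have h' : k ∈ δ ∧ i ∈ δ ∧ i ≠ k := ⟨h.2.1, h.1, h.2.2.symm⟩
      simp only [T]
      rw [if_pos h, if_pos h', totD_comm, Finset.erase_right_comm, ← neg_smul]
      congr 1
      rcases lt_or_gt_of_ne h.2.2 with hlt | hlt
      · have := card_filter_erase δ h.2.1 hlt
        rw [show ∀ a b : ℕ, -((-1 : ℝ) ^ (a + b)) = (-1) ^ (a + b + 1) from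
          fun a b => by rw [pow_succ]; ring, ← this, add_comm]
      · have := card_filter_erase δ h.1 hlt
        rw [add_comm (Finset.card _) (Finset.card (Finset.filter (· < i) (δ.erase k))), this,
          pow_succ]
        ring
    · have h' : ¬ (k ∈ δ ∧ i ∈ δ ∧ i ≠ k) := fun h' => h ⟨h'.2.1, h'.1, h'.2.2.symm⟩
      simp only [T]
      rw [if_neg h, if_neg h', neg_zero]
  have h1 : ∑ i ∈ δ, (-1 : ℝ) ^ (δ.filter (· < i)).card • totD i (dH N w (δ.erase i)) =
      ∑ i, ∑ k, T i k := by
    rw [← Finset.sum_subset (Finset.subset_univ δ)]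
    · refine Finset.sum_congr rfl fun i hi => ?_
      rw [← Finset.sum_subset (Finset.subset_univ (δ.erase i)), dH_apply, map_sum, Finset.smul_sum]
      · refine Finset.sum_congr rfl fun k hk => ?_
        rw [Finset.mem_erase] at hk
        simp only [T]
        rw [if_pos ⟨hi, hk.2, hk.1⟩, pow_add, mul_smul]
        congr 1
        exact (totD i).map_smul _ _
      · intro k _ hk
        rw [Finset.mem_erase] at hk
        exact if_neg fun h => hk ⟨h.2.2, h.2.1⟩
    · intro i _ hi
      exact Finset.sum_eq_zero fun k _ => if_neg fun h => hi h.1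
  rw [h1]
  exact sum_eq_zero_of_antisymm T hT

theorem compTensorD_compTensorD {N n : ℕ} (f : FormOp N n) :
    compTensorD N n (compTensorD N n f) = 0 := by
  refine MultilinearMap.ext fun w => ?_
  have hR : ∀ (f : FormOp N n) w, compTensorD N n f w = ∑ j, f fun l => tensorArg j l (w l) := by
    intro f w
    rw [compTensorD, LinearMap.sum_apply, _root_.sum_apply]
    rfl
  rw [hR]
  simp only [hR]
  rw [_root_.zero_apply]
  let T : Fin n → Fin n → Form N := fun j k => f fun l => tensorArg k l (tensorArg j l (w l))
  have hlt : ∀ j k, j < k → T j k = - T k j := by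
    intro j k hjk
    let v : Fin n → Form N := fun l => tensorArg k l (tensorArg j l (w l))
    let v' : Fin n → Form N := fun l => tensorArg j l (tensorArg k l (w l))
    have hv : v = Function.update v' j (-(v' j)) := by
      funext l
      by_cases hl : l = j
      · subst hl
        rw [Function.update_self]
        simp only [v, v', tensorArg, if_pos hjk, lt_irrefl, if_false, if_true]
        exact gradInv_dH _
      · rw [Function.update_of_ne hl]
        simp only [v, v', tensorArg]
        rcases lt_or_gt_of_ne hl with h | h
        · simp [h, h.trans hjk]
        · simp [h.not_gt, hl]
    change f v = - f v'
    rw [hv, show -(v' j) = (-1 : ℝ) • v' j by simp, MultilinearMap.map_update_smul,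
      Function.update_eq_self]
    simp
  have hT : ∀ j k, T j k = - T k j := by
    intro j k
    rcases lt_trichotomy j k with h | h | h
    · exact hlt j k h
    · subst h
      have : T j j = 0 := MultilinearMap.map_coord_zero f j (by simp [tensorArg, dH_dH])
      rw [this, neg_zero]
    · rw [hlt k j h, neg_neg]
  exact sum_eq_zero_of_antisymm T hT

theorem preDelta_preDelta {N n : ℕ} (k : ℤ) (f : FormOp N n) :
    preDelta N n (k - 1) (preDelta N n k f) = 0 := by
  have h1 : ∀ g : FormOp N n, compTensorD N n ((dH N).compMultilinearMap g) =
      (dH N).compMultilinearMap (compTensorD N n g) := by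
    intro g
    refine MultilinearMap.ext fun w => ?_
    simp only [compTensorD, LinearMap.sum_apply, _root_.sum_apply,
      LinearMap.compMultilinearMap_apply, map_sum]
    rfl
  have hd : ∀ g : FormOp N n, preDelta N n k g =
    (dH N).compMultilinearMap g - (-1 : ℝ) ^ k • compTensorD N n g := fun _ => rfl
  have hd' : ∀ g : FormOp N n, preDelta N n (k - 1) g =
    (dH N).compMultilinearMap g - (-1 : ℝ) ^ (k - 1) • compTensorD N n g := fun _ => rfl
  rw [hd', hd, map_sub, h1, map_smul, compTensorD_compTensorD, smul_zero, sub_zero]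
  refine MultilinearMap.ext fun w => ?_
  rw [zpow_sub_one₀ (by norm_num : (-1 : ℝ) ≠ 0)]
  simp [dH_dH]

theorem dH_single {N : ℕ} (ε : Finset (Fin N)) (h : Loc N) :
    dH N (Pi.single ε h) = ∑ i ∈ εᶜ, (-1 : ℝ) ^ ((insert i ε).filter (· < i)).card •
      (Pi.single (insert i ε) (totD i h) : Form N) := by
  funext δ
  rw [dH_apply, Finset.sum_apply]
  refine (Finset.sum_subset (Finset.inter_subset_left (s₂ := εᶜ)) ?_).symm.trans (Eq.trans ?_
    (Finset.sum_subset (Finset.inter_subset_right (s₁ := δ)) ?_))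
  · intro i hi hi'
    rw [Pi.single_apply, if_neg, map_zero, smul_zero]
    rintro rfl
    exact hi' (Finset.mem_inter.2 ⟨hi, by simp⟩)
  · refine Finset.sum_congr rfl fun i hi => ?_
    rw [Finset.mem_inter, Finset.mem_compl] at hi
    rw [Pi.smul_apply, Pi.single_apply, Pi.single_apply]
    by_cases he : δ = insert i ε
    · rw [if_pos he, if_pos (by rw [he, Finset.erase_insert hi.2]), he]
    · rw [if_neg he, if_neg, map_zero, smul_zero, smul_zero]
      rintro rfl
      exact he (Finset.insert_erase hi.1).symm
  · intro i hi hi'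
    rw [Pi.smul_apply, Pi.single_apply, if_neg, smul_zero]
    rintro rfl
    exact hi' (Finset.mem_inter.2 ⟨Finset.mem_insert_self _ _, hi⟩)

theorem preDelta_mem {N n : ℕ} {k l : ℤ} (hkl : l + 1 = k) {f : FormOp N n}
    (hf : f ∈ dEndSubmodule N n k) : preDelta N n k f ∈ dEndSubmodule N n l := by
  intro ε δ
  have key : matCoeff ε δ (preDelta N n k f) =
      ∑ i ∈ δ, (-1 : ℝ) ^ (δ.filter (· < i)).card • leftD i (matCoeff ε (δ.erase i) f) -
      (-1 : ℝ) ^ k • ∑ j, (∏ l, if l < j then (-1 : ℝ) ^ (N - (ε l).card) else 1) •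
        ∑ i ∈ (ε j)ᶜ, (-1 : ℝ) ^ ((insert i (ε j)).filter (· < i)).card •
          rightD i j (matCoeff (Function.update ε j (insert i (ε j))) δ f) := by
    refine MultilinearMap.ext fun h => ?_
    rw [matCoeff_apply, preDelta_apply, Pi.sub_apply, dH_apply, _root_.sub_apply, _root_.sum_apply,
      Pi.smul_apply, _root_.smul_apply, _root_.sum_apply, Finset.sum_apply]
    congr 2
    refine Finset.sum_congr rfl fun j _ => ?_
    have e1 : (fun l => tensorArg j l (Pi.single (ε l) (h l) : Form N)) = fun l =>
        (if l < j then (-1 : ℝ) ^ (N - (ε l).card) else 1) •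
          Function.update (fun l => (Pi.single (ε l) (h l) : Form N)) j
            (dH N (Pi.single (ε j) (h j))) l := by
      funext l
      by_cases hl : l = j
      · subst hl
        simp [tensorArg]
      · rw [Function.update_of_ne hl, tensorArg]
        by_cases hlt : l < j
        · rw [if_pos hlt, if_pos hlt]
          funext δ
          rw [gradInv_apply, Pi.smul_apply]
          by_cases hδ : δ = ε l
          · rw [hδ]
          · rw [Pi.single_eq_of_ne hδ, smul_zero, smul_zero]
        · rw [if_neg hlt, if_neg hlt, if_neg hl, one_smul]
          rfl
    rw [e1, MultilinearMap.map_smul_univ, dH_single, MultilinearMap.map_update_sum, Pi.smul_apply,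
      Finset.sum_apply, _root_.smul_apply, _root_.sum_apply]
    congr 1
    refine Finset.sum_congr rfl fun i _ => ?_
    rw [MultilinearMap.map_update_smul, Pi.smul_apply, _root_.smul_apply, rightD_apply,
      matCoeff_apply]
    congr 1
    refine congrArg (fun q => f q δ) (funext fun l => ?_)
    by_cases hl : l = j
    · subst hl
      simp
    · simp [hl]
  have hL : ∀ i ∈ δ, DegreeMatch k ε (δ.erase i) → DegreeMatch l ε δ := by
    intro i hi h
    unfold DegreeMatch at h ⊢
    have := Finset.card_erase_add_one hi
    omega
  have hR : ∀ j, ∀ i ∈ (ε j)ᶜ, DegreeMatch k (Function.update ε j (insert i (ε j))) δ →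
      DegreeMatch l ε δ := by
    intro j i hi h
    unfold DegreeMatch at h ⊢
    rw [← Finset.add_sum_erase _ _ (Finset.mem_univ j)] at h ⊢
    rw [Function.update_self, Finset.card_insert_of_notMem (Finset.mem_compl.1 hi),
      Finset.sum_congr (g := fun j => (N : ℤ) - (ε j).card) rfl fun l hl => by
        rw [Function.update_of_ne (Finset.ne_of_mem_erase hl)]] at h
    push_cast at h
    omega
  rw [key]
  constructor
  · refine sub_mem (sum_mem fun i _ => Submodule.smul_mem _ _ (leftD_mem i (hf _ _).1))
      (Submodule.smul_mem _ _ (sum_mem fun j _ => Submodule.smul_mem _ _ (sum_mem fun i _ =>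
        Submodule.smul_mem _ _ (rightD_mem i j (hf _ _).1))))
  · intro hn
    rw [Finset.sum_eq_zero, Finset.sum_eq_zero, smul_zero, sub_zero]
    · intro j _
      rw [Finset.sum_eq_zero, smul_zero]
      intro i hi
      rw [(hf _ _).2 fun h => hn (hR j i hi h), map_zero, smul_zero]
    · intro i hi
      rw [(hf _ _).2 fun h => hn (hL i hi h), map_zero, smul_zero]

/-- The differential `δ : DEnd_k(n) → DEnd_{k-1}(n)`. -/
noncomputable def delta (N n : ℕ) (k l : ℤ) (hkl : l + 1 = k) : DEnd N n k →ₗ[ℝ] DEnd N n l where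
  toFun f := ⟨preDelta N n k f.1, preDelta_mem hkl f.2⟩
  map_add' f g := Subtype.ext (map_add (preDelta N n k) f.1 g.1)
  map_smul' r f := Subtype.ext (map_smul (preDelta N n k) r f.1)

theorem delta_delta {N n : ℕ} {k l m : ℤ} (hkl : l + 1 = k) (hlm : m + 1 = l) (f : DEnd N n k) :
    delta N n l m hlm (delta N n k l hkl f) = 0 := by
  obtain rfl : l = k - 1 := by omega
  exact Subtype.ext (preDelta_preDelta k f.1)

/-- The cycles `Z_k(DEnd_*(n))`. -/
noncomputable def cycles (N n : ℕ) (k : ℤ) : Submodule ℝ (DEnd N n k) :=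
  LinearMap.ker (delta N n k (k - 1) (by omega))

/-- The boundaries in `DEnd_k(n)`. -/
noncomputable def boundaries (N n : ℕ) (k : ℤ) : Submodule ℝ (DEnd N n k) :=
  LinearMap.range (delta N n (k + 1) k rfl)

/-- The homology `H_k(DEnd_*(n), δ)`: cycles modulo boundaries. -/
abbrev Homology (N n : ℕ) (k : ℤ) : Type :=
  cycles N n k ⧸ (boundaries N n k).submoduleOf (cycles N n k)

/-- The projection `B₀ : DEnd_0(n) → LDO(n)` to the lowest component `f_0 : [Ω_*^{⊗n}]_0 → Ω_0`,
where `Ω_0` is identified with `Loc(E)` through `h ↦ h dx^1 ∧ ⋯ ∧ dx^N`. -/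
noncomputable def bZero (N n : ℕ) : DEnd N n 0 →ₗ[ℝ] LDO N n where
  toFun f := ⟨matCoeff (fun _ => Finset.univ) Finset.univ f.1, (f.2 _ _).1⟩
  map_add' f g := Subtype.ext (map_add (matCoeff _ _) f.1 g.1)
  map_smul' r f := Subtype.ext (map_smul (matCoeff _ _) r f.1)

end JetLDO

/-!
The operators `A ↦ d/dx^i ∘ A` make `LDO(n)` a module over the polynomial ring `ℝ[D_1, …, D_N]`, and
this module is free. In polarized form `d/dx^i ∘ A` has the symbol `X_{0,i} q + C_i q`, where `C_i`
differentiates the coefficients of the symbol `q` of `A`, and the change of variables `shear` removes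
the term `C_i`: it amounts to writing `A = ∑ (d/dx)^I ∘ B_I` with `B_I` free of `d/dy_1`. In this
`normalForm` the operator `d/dx^i ∘ -` is the multiplication by `X_{0,i}`, and the vanishing of
`χ(A)` is the vanishing of the part `B_0` (`chi_eq_zero_iff`).

For fixed arguments `(dx)^{ε_1}, …, (dx)^{ε_n}` the differential `f ↦ d_H ∘ f` is therefore the Koszul
differential of a free module. Interior products with the partial derivatives in the `X_{0,i}`, divided
by the eigenvalues of the Euler operator, contract it except in top form degree, where the cohomology
is detected by `χ` (`koszul_homotopy`).

The other half `f ↦ f ∘ d_H^{⊗n}` of `δ` raises the source degree. Hence, if a cycle `c` vanishes in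
source degrees below `s`, subtracting `δ` of its contraction gives a cycle that vanishes in source
degrees up to `s`, unless `c` meets the cohomology of the Koszul complex, which happens only for values
in top forms. The source degree is bounded, so the process ends and `c` is a boundary
(`exists_delta_eq_of_lt`, `exists_delta_eq`). This gives the acyclicity in positive degrees, shows that
a `0`-cycle is a boundary once `χ(B₀ f) = 0`, and, applied to `δ` of the extension by zero of an
operator in `Ker(a₀)`, shows that each such operator is `B₀` of a `0`-cycle.
-/

namespace JetLDO

/-! ### Monomials and differentiation of coefficients -/

theorem X_mul_monomial {N n : ℕ} (p : Fin n × Fin N) (m : Fin n × Fin N →₀ ℕ) (r : Loc N) :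
    (MvPolynomial.X p * MvPolynomial.monomial m r : HorPoly N n) =
      MvPolynomial.monomial (m + Finsupp.single p 1) r := by
  rw [MvPolynomial.X, MvPolynomial.monomial_mul, one_mul, add_comm]

theorem curry_add_single {N n : ℕ} (m : Fin n × Fin N →₀ ℕ) (j : Fin n) (i : Fin N) :
    (m + Finsupp.single (j, i) 1).curry j = m.curry j + Finsupp.single i 1 := by
  ext k
  simp [Finsupp.curry_apply, Finsupp.single_apply]

theorem curry_add_single_of_ne {N n : ℕ} (m : Fin n × Fin N →₀ ℕ) {p : Fin n × Fin N} {j : Fin n}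
    (hp : p.1 ≠ j) : (m + Finsupp.single p 1).curry j = m.curry j := by
  ext k
  have : p ≠ (j, k) := fun h => hp (by rw [h])
  simp [Finsupp.curry_apply, this]

theorem degree_curry {N n : ℕ} (m : Fin n × Fin N →₀ ℕ) (j : Fin n) :
    (m.curry j).degree = ∑ i, m (j, i) := by
  rw [Finsupp.degree_eq_sum]
  simp [Finsupp.curry_apply]

theorem coeffD_monomial {N n : ℕ} (i : Fin N) (m : Fin n × Fin N →₀ ℕ) (r : Loc N) :
    coeffD i (MvPolynomial.monomial m r : HorPoly N n) = MvPolynomial.monomial m (totD i r) :=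
  coeffwise_monomial _ _ _

theorem coeffD_C {N n : ℕ} (i : Fin N) (r : Loc N) :
    coeffD i (MvPolynomial.C r : HorPoly N n) = MvPolynomial.C (totD i r) :=
  coeffD_monomial i 0 r

theorem coeffD_X_mul {N n : ℕ} (i : Fin N) (p : Fin n × Fin N) (Q : HorPoly N n) :
    coeffD i (MvPolynomial.X p * Q) = MvPolynomial.X p * coeffD i Q := by
  induction Q using MvPolynomial.induction_on' with
  | monomial m r => rw [X_mul_monomial, coeffD_monomial, coeffD_monomial, X_mul_monomial]
  | add P Q hP hQ => rw [mul_add, map_add, hP, hQ, map_add, mul_add]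

theorem coeffD_comm {N n : ℕ} (i k : Fin N) (Q : HorPoly N n) :
    coeffD i (coeffD k Q) = coeffD k (coeffD i Q) := by
  induction Q using MvPolynomial.induction_on' with
  | monomial m r => simp only [coeffD_monomial, totD_comm i k]
  | add P Q hP hQ => simp only [map_add, hP, hQ]

/-- The effect of `A ↦ d/dx^i ∘ A` on total symbols. -/
noncomputable def leftSymb {N n : ℕ} (i : Fin N) : Module.End ℝ (HorPoly N n) :=
  coeffD i + ∑ j, LinearMap.mulLeft ℝ (MvPolynomial.X (j, i))

theorem leftSymb_apply {N n : ℕ} (i : Fin N) (Q : HorPoly N n) :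
    leftSymb i Q = coeffD i Q + ∑ j, MvPolynomial.X (j, i) * Q := by
  rw [leftSymb, LinearMap.add_apply, LinearMap.sum_apply]
  rfl

/-! ### Normal form of the symbol under post-composition with total derivatives -/

section Polarization

variable {N n : ℕ} [NeZero n]

/-- The operator `X_{0,i} + t C_i` on polynomials, where `C_i` applies `d/dx^i` to the
coefficients. For `t = 1` it is the effect of `A ↦ d/dx^i ∘ A` on polarized symbols. -/
noncomputable def shiftX (t : ℝ) (i : Fin N) : Module.End ℝ (HorPoly N n) :=
  LinearMap.mulLeft ℝ (MvPolynomial.X (0, i)) + t • coeffD i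

theorem shiftX_apply (t : ℝ) (i : Fin N) (Q : HorPoly N n) :
    shiftX t i Q = MvPolynomial.X (0, i) * Q + t • coeffD i Q := rfl

theorem commute_shiftX (t : ℝ) (i k : Fin N) :
    Commute (shiftX t i : Module.End ℝ (HorPoly N n)) (shiftX t k) := by
  refine LinearMap.ext fun Q => ?_
  change shiftX t i (shiftX t k Q) = shiftX t k (shiftX t i Q)
  simp only [shiftX_apply, map_add, map_smul, coeffD_X_mul, coeffD_comm i k,
    smul_add]
  rw [mul_left_comm]
  abel

/-- The `ℝ`-linear map which replaces each power `X_{0,i}^a` by `(X_{0,i} + t C_i)^a`; here the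
coefficient of a monomial is placed to the right of the `X_{0,i}`. -/
noncomputable def shear (t : ℝ) : HorPoly N n →ₗ[ℝ] HorPoly N n :=
  coeffwise fun m => opPow (shiftX t) (commute_shiftX t) (m.curry 0) ∘ₗ
    (MvPolynomial.monomial (m.filter fun p => p.1 ≠ 0)).restrictScalars ℝ

theorem shear_monomial (t : ℝ) (m : Fin n × Fin N →₀ ℕ) (r : Loc N) :
    shear t (MvPolynomial.monomial m r) = opPow (shiftX t) (commute_shiftX t) (m.curry 0)
      (MvPolynomial.monomial (m.filter fun p => p.1 ≠ 0) r) :=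
  coeffwise_monomial _ _ _

theorem shear_C (t : ℝ) (r : Loc N) :
    shear t (MvPolynomial.C r : HorPoly N n) = MvPolynomial.C r := by
  rw [MvPolynomial.C_apply, shear_monomial]
  have h : ((0 : Fin n × Fin N →₀ ℕ).curry 0) = 0 := by ext; simp [Finsupp.curry_apply]
  rw [h, opPow_zero, Finsupp.filter_zero]
  rfl

theorem filter_add_single (m : Fin n × Fin N →₀ ℕ) (i : Fin N) :
    (m + Finsupp.single (0, i) 1).filter (fun p => p.1 ≠ 0) = m.filter fun p => p.1 ≠ 0 := by
  rw [Finsupp.filter_add, Finsupp.filter_single_of_neg _ (by simp), add_zero]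

theorem filter_add_single_of_ne (m : Fin n × Fin N →₀ ℕ) {p : Fin n × Fin N} (hp : p.1 ≠ 0) :
    (m + Finsupp.single p 1).filter (fun p => p.1 ≠ 0) =
      m.filter (fun p => p.1 ≠ 0) + Finsupp.single p 1 := by
  rw [Finsupp.filter_add, Finsupp.filter_single_of_pos (fun p : Fin n × Fin N => p.1 ≠ 0) hp]

theorem shear_X_zero_mul (t : ℝ) (i : Fin N) (Q : HorPoly N n) :
    shear t (MvPolynomial.X (0, i) * Q) = shiftX t i (shear t Q) := by
  induction Q using MvPolynomial.induction_on' with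
  | monomial m r =>
    rw [X_mul_monomial, shear_monomial, shear_monomial, curry_add_single, filter_add_single,
      add_comm, opPow_add, opPow_single]
    rfl
  | add P Q hP hQ => rw [mul_add, map_add, hP, hQ, map_add, map_add]

theorem opPow_shiftX_X_mul (t : ℝ) (I : Fin N →₀ ℕ) (p : Fin n × Fin N) (Q : HorPoly N n) :
    opPow (shiftX t) (commute_shiftX t) I (MvPolynomial.X p * Q) =
      MvPolynomial.X p * opPow (shiftX t) (commute_shiftX t) I Q := by
  induction I using finsupp_nat_induction generalizing Q with
  | h0 => rw [opPow_zero]; rfl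
  | h1 I i ih =>
    rw [opPow_add, opPow_single, Module.End.mul_apply, Module.End.mul_apply, ← ih]
    congr 1
    rw [shiftX_apply, shiftX_apply, coeffD_X_mul, mul_add, mul_left_comm, mul_smul_comm]

theorem shear_X_mul (t : ℝ) {p : Fin n × Fin N} (hp : p.1 ≠ 0) (Q : HorPoly N n) :
    shear t (MvPolynomial.X p * Q) = MvPolynomial.X p * shear t Q := by
  induction Q using MvPolynomial.induction_on' with
  | monomial m r =>
    rw [X_mul_monomial, shear_monomial, shear_monomial, curry_add_single_of_ne m hp,
      filter_add_single_of_ne m hp, ← X_mul_monomial, opPow_shiftX_X_mul]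
  | add P Q hP hQ => rw [mul_add, map_add, hP, hQ, map_add, mul_add]

theorem coeffD_shear (t : ℝ) (i : Fin N) (Q : HorPoly N n) :
    coeffD i (shear t Q) = shear t (coeffD i Q) := by
  induction Q using MvPolynomial.induction_on with
  | C r => rw [shear_C, coeffD_C, shear_C]
  | add P Q hP hQ => simp only [map_add, hP, hQ]
  | mul_X Q p ih =>
    obtain ⟨j, k⟩ := p
    rw [mul_comm, coeffD_X_mul]
    by_cases hj : j = 0
    · subst hj
      rw [shear_X_zero_mul, shear_X_zero_mul, shiftX_apply, shiftX_apply, map_add, coeffD_X_mul,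
        map_smul, coeffD_comm i k, ih]
    · rw [shear_X_mul t hj, shear_X_mul t hj, coeffD_X_mul, ih]

theorem shear_shear {s t : ℝ} (hst : s + t = 0) (Q : HorPoly N n) : shear s (shear t Q) = Q := by
  induction Q using MvPolynomial.induction_on with
  | C r => rw [shear_C, shear_C]
  | add P Q hP hQ => simp only [map_add, hP, hQ]
  | mul_X Q p ih =>
    obtain ⟨j, k⟩ := p
    rw [mul_comm]
    by_cases hj : j = 0
    · subst hj
      rw [shear_X_zero_mul, shiftX_apply, map_add, map_smul, shear_X_zero_mul, shiftX_apply,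
        ← coeffD_shear, ih, add_assoc, ← add_smul, hst, zero_smul, add_zero]
    · rw [shear_X_mul t hj, shear_X_mul s hj, ih]

theorem polarize_X_mul {p : Fin n × Fin N} (hp : p.1 ≠ 0) (Q : HorPoly N n) :
    polarize (MvPolynomial.X p * Q) = MvPolynomial.X p * polarize Q := by
  rw [map_mul, polarize, MvPolynomial.aeval_X, if_neg hp]

theorem polarize_X_zero_mul (i : Fin N) (Q : HorPoly N n) :
    polarize (MvPolynomial.X (0, i) * Q) = MvPolynomial.X (0, i) * polarize Q -
      ∑ j ∈ Finset.univ.erase (0 : Fin n), MvPolynomial.X (j, i) * polarize Q := by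
  rw [map_mul, polarize, MvPolynomial.aeval_X, if_pos rfl, sub_mul, Finset.sum_mul]

theorem coeffD_polarize (i : Fin N) (Q : HorPoly N n) :
    coeffD i (polarize Q) = polarize (coeffD i Q) := by
  induction Q using MvPolynomial.induction_on with
  | C r =>
    rw [coeffD_C, ← MvPolynomial.algebraMap_eq, AlgHom.commutes, AlgHom.commutes,
      MvPolynomial.algebraMap_eq, coeffD_C]
  | add P Q hP hQ => simp only [map_add, hP, hQ]
  | mul_X Q p ih =>
    obtain ⟨j, k⟩ := p
    rw [mul_comm, coeffD_X_mul]
    by_cases hj : j = 0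
    · subst hj
      rw [polarize_X_zero_mul, polarize_X_zero_mul, map_sub, map_sum]
      simp only [coeffD_X_mul, ih]
    · rw [polarize_X_mul hj, polarize_X_mul hj, coeffD_X_mul, ih]

theorem polarize_sum_X_mul (i : Fin N) (Q : HorPoly N n) :
    polarize (∑ j, MvPolynomial.X (j, i) * Q) = MvPolynomial.X (0, i) * polarize Q := by
  rw [← Finset.add_sum_erase _ _ (Finset.mem_univ (0 : Fin n)), map_add, map_sum,
    polarize_X_zero_mul, Finset.sum_congr rfl fun j hj =>
      polarize_X_mul (p := (j, i)) (Finset.ne_of_mem_erase hj) Q, sub_add_cancel]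

/-- The inverse of `polarize`: the substitution `d/dy_1 = d/dx_1 + ⋯ + d/dx_n`. -/
noncomputable def unpolarize : HorPoly N n →ₐ[Loc N] HorPoly N n :=
  MvPolynomial.aeval fun p => if p.1 = 0 then ∑ j, MvPolynomial.X (j, p.2) else MvPolynomial.X p

theorem unpolarize_polarize (Q : HorPoly N n) : unpolarize (polarize Q) = Q := by
  have h : (unpolarize.comp polarize : HorPoly N n →ₐ[Loc N] HorPoly N n) = AlgHom.id _ _ := by
    refine MvPolynomial.algHom_ext fun p => ?_
    obtain ⟨j, k⟩ := p
    rw [AlgHom.comp_apply, polarize, MvPolynomial.aeval_X, AlgHom.id_apply]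
    by_cases hj : j = 0
    · subst hj
      rw [if_pos rfl, map_sub, map_sum, unpolarize, MvPolynomial.aeval_X, if_pos rfl,
        Finset.sum_congr (s₁ := Finset.univ.erase (0 : Fin n))
          (g := fun j => (MvPolynomial.X (j, k) : HorPoly N n)) rfl fun j hj => by
            rw [MvPolynomial.aeval_X, if_neg (Finset.ne_of_mem_erase hj)],
        ← Finset.add_sum_erase _ _ (Finset.mem_univ (0 : Fin n)), add_sub_cancel_right]
    · rw [if_neg hj, unpolarize, MvPolynomial.aeval_X, if_neg hj]
  exact DFunLike.congr_fun h Q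

theorem polarize_unpolarize (Q : HorPoly N n) : polarize (unpolarize Q) = Q := by
  have h : (polarize.comp unpolarize : HorPoly N n →ₐ[Loc N] HorPoly N n) = AlgHom.id _ _ := by
    refine MvPolynomial.algHom_ext fun p => ?_
    obtain ⟨j, k⟩ := p
    rw [AlgHom.comp_apply, unpolarize, MvPolynomial.aeval_X, AlgHom.id_apply]
    by_cases hj : j = 0
    · subst hj
      rw [if_pos rfl]
      simpa using polarize_sum_X_mul k (1 : HorPoly N n)
    · rw [if_neg hj, polarize, MvPolynomial.aeval_X, if_neg hj]
  exact DFunLike.congr_fun h Q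

/-- The normal form of a symbol: the polynomial `∑ X^I r_I` with `r_I` free of the `X_{0,i}`
attached to the symbol of `∑ (d/dx)^I ∘ B_I`, where `B_I` has symbol `r_I`. -/
noncomputable def normalForm : HorPoly N n ≃ₗ[ℝ] HorPoly N n where
  toFun Q := shear (-1) (polarize Q)
  invFun Q := unpolarize (shear 1 Q)
  map_add' P Q := by rw [map_add, map_add]
  map_smul' r Q := by
    rw [RingHom.id_apply, ← map_smul]
    exact congrArg _ (map_smul (polarize.restrictScalars ℝ) r Q)
  left_inv Q := by
    change unpolarize (shear 1 (shear (-1) (polarize Q))) = Q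
    rw [shear_shear (by norm_num), unpolarize_polarize]
  right_inv Q := by
    change shear (-1) (polarize (unpolarize (shear 1 Q))) = Q
    rw [polarize_unpolarize, shear_shear (by norm_num)]

theorem normalForm_apply (Q : HorPoly N n) : normalForm Q = shear (-1) (polarize Q) := rfl

theorem normalForm_leftSymb (i : Fin N) (Q : HorPoly N n) :
    normalForm (leftSymb i Q) = MvPolynomial.X (0, i) * normalForm Q := by
  rw [leftSymb_apply, normalForm_apply, normalForm_apply, map_add, polarize_sum_X_mul, map_add,
    shear_X_zero_mul, shiftX_apply, ← coeffD_polarize, ← coeffD_shear, neg_one_smul]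
  abel

/-! ### The characteristic and the Euler operator on normal forms -/

/-- The projection of polynomials to the part free of the variables `X_{0,i}`. -/
noncomputable def freePart : HorPoly N n →ₗ[ℝ] HorPoly N n :=
  coeffwise fun m => if m.curry 0 = 0 then (MvPolynomial.monomial m).restrictScalars ℝ else 0

theorem freePart_monomial (m : Fin n × Fin N →₀ ℕ) (r : Loc N) :
    freePart (MvPolynomial.monomial m r) =
      if m.curry 0 = 0 then MvPolynomial.monomial m r else 0 := by
  rw [freePart, coeffwise_monomial]
  split_ifs <;> rfl

theorem freePart_X_zero_mul (i : Fin N) (Q : HorPoly N n) :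
    freePart (MvPolynomial.X (0, i) * Q) = 0 := by
  induction Q using MvPolynomial.induction_on' with
  | monomial m r =>
    rw [X_mul_monomial, freePart_monomial, curry_add_single, if_neg]
    intro h
    have := DFunLike.congr_fun h i
    simp at this
  | add P Q hP hQ => rw [mul_add, map_add, hP, hQ, add_zero]

theorem freePart_X_mul {p : Fin n × Fin N} (hp : p.1 ≠ 0) (Q : HorPoly N n) :
    freePart (MvPolynomial.X p * Q) = MvPolynomial.X p * freePart Q := by
  induction Q using MvPolynomial.induction_on' with
  | monomial m r =>
    rw [X_mul_monomial, freePart_monomial, freePart_monomial, curry_add_single_of_ne m hp, mul_ite,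
      mul_zero, X_mul_monomial]
  | add P Q hP hQ => rw [mul_add, map_add, hP, hQ, map_add, mul_add]

theorem freePart_coeffD (i : Fin N) (Q : HorPoly N n) :
    freePart (coeffD i Q) = coeffD i (freePart Q) := by
  induction Q using MvPolynomial.induction_on' with
  | monomial m r =>
    rw [coeffD_monomial, freePart_monomial, freePart_monomial]
    split_ifs
    · rw [coeffD_monomial]
    · rw [map_zero]
  | add P Q hP hQ => simp only [map_add, hP, hQ]

theorem charPoly_monomial (m : Fin n × Fin N →₀ ℕ) (r : Loc N) :
    charPoly (MvPolynomial.monomial m r) = MvPolynomial.monomial (m.filter fun p => p.1 ≠ 0)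
      ((-1 : ℝ) ^ (m.curry 0).degree • totDPow (m.curry 0) r) :=
  coeffwise_monomial _ _ _

theorem charPoly_X_zero_mul (i : Fin N) (Q : HorPoly N n) :
    charPoly (MvPolynomial.X (0, i) * Q) = -coeffD i (charPoly Q) := by
  induction Q using MvPolynomial.induction_on' with
  | monomial m r =>
    rw [X_mul_monomial, charPoly_monomial, charPoly_monomial, curry_add_single, filter_add_single,
      coeffD_monomial, totDPow_add_single', map_add, Finsupp.degree_single, pow_succ, ← map_neg]
    congr 1
    have h : totD i ((-1 : ℝ) ^ (m.curry 0).degree • totDPow (m.curry 0) r) =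
      (-1 : ℝ) ^ (m.curry 0).degree • totD i (totDPow (m.curry 0) r) := (totD i).map_smul _ _
    rw [h, mul_neg_one, neg_smul]
  | add P Q hP hQ => rw [mul_add, map_add, hP, hQ, map_add, map_add, neg_add]

theorem charPoly_X_mul {p : Fin n × Fin N} (hp : p.1 ≠ 0) (Q : HorPoly N n) :
    charPoly (MvPolynomial.X p * Q) = MvPolynomial.X p * charPoly Q := by
  induction Q using MvPolynomial.induction_on' with
  | monomial m r =>
    rw [X_mul_monomial, charPoly_monomial, charPoly_monomial, curry_add_single_of_ne m hp,
      filter_add_single_of_ne m hp, X_mul_monomial]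
  | add P Q hP hQ => rw [mul_add, map_add, hP, hQ, map_add, mul_add]

/-- The characteristic keeps the part of the normal form which is free of the `X_{0,i}`. -/
theorem charPoly_eq_freePart_shear (Q : HorPoly N n) : charPoly Q = freePart (shear (-1) Q) := by
  induction Q using MvPolynomial.induction_on with
  | C r =>
    have h : ((0 : Fin n × Fin N →₀ ℕ).curry 0) = 0 := by ext; simp [Finsupp.curry_apply]
    rw [shear_C, MvPolynomial.C_apply, charPoly_monomial, freePart_monomial, if_pos h, h,
      totDPow_zero, map_zero, pow_zero, one_smul, Finsupp.filter_zero]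
  | add P Q hP hQ => simp only [map_add, hP, hQ]
  | mul_X Q p ih =>
    obtain ⟨j, k⟩ := p
    rw [mul_comm]
    by_cases hj : j = 0
    · subst hj
      rw [charPoly_X_zero_mul, shear_X_zero_mul, shiftX_apply, map_add, freePart_X_zero_mul,
        map_smul, freePart_coeffD, ih, zero_add, neg_one_smul]
    · rw [charPoly_X_mul hj, shear_X_mul _ hj, freePart_X_mul hj, ih]

/-- The weighted partial derivative `X^m ↦ m_i / (|m| + c) X^{m - e_i}` with respect to `X_{0,i}`,
where `|m|` is the degree in the variables `X_{0,1}, …, X_{0,N}` only. -/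
noncomputable def weightedD (c : ℝ) (i : Fin N) : HorPoly N n →ₗ[ℝ] HorPoly N n :=
  coeffwise fun m => ((m (0, i) : ℝ) / ((m.curry 0).degree + c)) •
    (MvPolynomial.monomial (m - Finsupp.single (0, i) 1)).restrictScalars ℝ

theorem weightedD_monomial (c : ℝ) (i : Fin N) (m : Fin n × Fin N →₀ ℕ) (r : Loc N) :
    weightedD c i (MvPolynomial.monomial m r) = ((m (0, i) : ℝ) / ((m.curry 0).degree + c)) •
      (MvPolynomial.monomial (m - Finsupp.single (0, i) 1) r : HorPoly N n) :=
  coeffwise_monomial _ _ _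

theorem X_mul_weightedD (c : ℝ) {i k : Fin N} (hik : i ≠ k) (Q : HorPoly N n) :
    MvPolynomial.X (0, i) * weightedD c k Q =
      weightedD (c - 1) k (MvPolynomial.X (0, i) * Q) := by
  induction Q using MvPolynomial.induction_on' with
  | monomial m r =>
    rw [X_mul_monomial, weightedD_monomial, weightedD_monomial, mul_smul_comm, X_mul_monomial,
      curry_add_single, map_add, Finsupp.degree_single]
    have h1 : (m + Finsupp.single ((0 : Fin n), i) 1 : Fin n × Fin N →₀ ℕ) (0, k) = m (0, k) := by simp [hik]
    rw [h1]
    by_cases h0 : m (0, k) = 0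
    · simp [h0]
    · rw [tsub_add_eq_add_tsub (by
        simpa [Finsupp.single_le_iff] using Nat.one_le_iff_ne_zero.2 h0)]
      congr 2
      push_cast
      ring
  | add P Q hP hQ => simp only [mul_add, map_add, hP, hQ]

theorem X_mul_weightedD_self (c : ℝ) (i : Fin N) (m : Fin n × Fin N →₀ ℕ) (r : Loc N) :
    MvPolynomial.X (0, i) * weightedD c i (MvPolynomial.monomial m r) =
      ((m (0, i) : ℝ) / ((m.curry 0).degree + c)) • (MvPolynomial.monomial m r : HorPoly N n) := by
  rw [weightedD_monomial, mul_smul_comm, X_mul_monomial]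
  by_cases h0 : m (0, i) = 0
  · simp [h0]
  · rw [tsub_add_cancel_of_le (by
      simpa [Finsupp.single_le_iff] using Nat.one_le_iff_ne_zero.2 h0)]

theorem weightedD_X_mul_self (c : ℝ) (i : Fin N) (m : Fin n × Fin N →₀ ℕ) (r : Loc N) :
    weightedD (c - 1) i (MvPolynomial.X (0, i) * MvPolynomial.monomial m r) =
      ((m (0, i) + 1 : ℝ) / ((m.curry 0).degree + c)) •
        (MvPolynomial.monomial m r : HorPoly N n) := by
  rw [X_mul_monomial, weightedD_monomial, curry_add_single, map_add, Finsupp.degree_single,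
    add_tsub_cancel_right]
  congr 2
  · simp
  · push_cast
    ring

/-- The diagonal part of the Koszul homotopy identity: with the weight `c = N - |δ|` the Euler
operator is inverted, except on the polynomials free of the `X_{0,i}` when `c = 0`. -/
theorem euler_identity (δ : Finset (Fin N)) (Q : HorPoly N n) :
    ∑ i ∈ δ, MvPolynomial.X (0, i) * weightedD (δᶜ.card : ℝ) i Q +
      ∑ k ∈ δᶜ, weightedD ((δᶜ.card : ℝ) - 1) k (MvPolynomial.X (0, k) * Q) =
    Q - if δ = Finset.univ then freePart Q else 0 := by
  induction Q using MvPolynomial.induction_on' with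
  | monomial m r =>
    simp only [X_mul_weightedD_self, weightedD_X_mul_self, ← Finset.sum_smul, ← add_smul,
      ← Finset.sum_div, ← add_div, Finset.sum_add_distrib, Finset.sum_const, nsmul_eq_mul, mul_one]
    have h1 : ∑ i ∈ δ, (m (0, i) : ℝ) + (∑ i ∈ δᶜ, (m (0, i) : ℝ) + δᶜ.card) =
        (m.curry 0).degree + δᶜ.card := by
      rw [← add_assoc, Finset.sum_add_sum_compl, degree_curry]
      push_cast
      rfl
    rw [h1, freePart_monomial]
    by_cases h0 : (m.curry 0).degree = 0 ∧ δᶜ.card = 0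
    · rw [if_pos (by simpa using h0.2), if_pos ((Finsupp.degree_eq_zero_iff _).1 h0.1), h0.1, h0.2]
      simp
    · have h2 : ((m.curry 0).degree + δᶜ.card : ℝ) ≠ 0 := by
        norm_cast
        omega
      rw [div_self h2, one_smul]
      by_cases hδ : δ = Finset.univ
      · rw [if_pos hδ, if_neg, sub_zero]
        intro h
        exact h0 ⟨by rw [h, map_zero], by simp [hδ]⟩
      · rw [if_neg hδ, sub_zero]
  | add P Q hP hQ =>
    simp only [mul_add, map_add, Finset.sum_add_distrib]
    rw [add_add_add_comm, hP, hQ]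
    split_ifs
    · abel
    · abel

end Polarization

/-! ### Action on multilinear local differential operators -/

section Operators

variable {N n : ℕ}

/-- Post-composition `A ↦ d/dx^i ∘ A` on `LDO(n)`. -/
noncomputable def ldoLeftD (i : Fin N) : Module.End ℝ (LDO N n) where
  toFun A := ⟨leftD i A.1, leftD_mem i A.2⟩
  map_add' A B := Subtype.ext (map_add (leftD i) A.1 B.1)
  map_smul' r A := Subtype.ext (map_smul (leftD i) r A.1)

theorem ldoRightD_ldoLeftD (i k : Fin N) (j : Fin n) (A : LDO N n) :
    ldoRightD i j (ldoLeftD k A) = ldoLeftD k (ldoRightD i j A) := by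
  refine Subtype.ext (MultilinearMap.ext fun f => ?_)
  change rightD i j (leftD k A.1) f = totD k (rightD i j A.1 f)
  rw [rightD_apply, rightD_apply]
  rfl

/-- A linear map on polynomials, applied to each of the polynomials that make up a total symbol. -/
noncomputable def symbMap (φ : Module.End ℝ (HorPoly N n)) : Module.End ℝ (Symb N n) where
  toFun c := ⟨fun α => φ ((c : VIdx N n → HorPoly N n) α), fun m => (c.2 m).subset
    fun α hα => ⟨hα.1, fun h => hα.2 (by simp [h])⟩⟩
  map_add' c d := Subtype.ext (funext fun α => map_add φ _ _)
  map_smul' r c := Subtype.ext (funext fun α => map_smul φ r _)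

theorem symbMap_apply (φ : Module.End ℝ (HorPoly N n)) (c : Symb N n) (α : VIdx N n) :
    (symbMap φ c : VIdx N n → HorPoly N n) α = φ ((c : VIdx N n → HorPoly N n) α) := rfl

/-- The algebra homomorphism which lets linear maps of polynomials act on `LDO(n)` through the
total symbol, separately for each vertical exponent. -/
noncomputable def ldoMap : Module.End ℝ (HorPoly N n) →ₐ[ℝ] Module.End ℝ (LDO N n) :=
  ((symbolEquiv N n).conjAlgEquiv ℝ).toAlgHom.comp (AlgHom.ofLinearMap
    { toFun := symbMap
      map_add' := fun _ _ => rfl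
      map_smul' := fun _ _ => rfl } rfl fun _ _ => rfl)

theorem ldoMap_apply (φ : Module.End ℝ (HorPoly N n)) (A : LDO N n) :
    ldoMap φ A = symbolEquiv N n (symbMap φ ((symbolEquiv N n).symm A)) := rfl

theorem leftD_op (i : Fin N) (c : Symb N n) :
    leftD i (op c) = op (symbMap (leftSymb i) c) := by
  refine MultilinearMap.ext fun f => ?_
  change totDEnd i (op c f) = _
  rw [op_apply, op_apply, show ∀ x, totDEnd i x = (totDEnd i).toAddMonoidHom x from fun _ => rfl,
    AddMonoidHom.map_finsum _ (finite_vertOp _ _ c.2 f)]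
  refine finsum_congr fun α => ?_
  rw [symbMap_apply, leftSymb_apply, map_add, map_sum, _root_.add_apply, _root_.sum_apply]
  simp only [vertOp_apply, horOp_X_mul]
  exact totD_horOp i _ _

variable [NeZero n]

/-- Linear maps of polynomials, acting on `LDO(n)` through the normal form of the symbol. -/
noncomputable def normalMap : Module.End ℝ (HorPoly N n) →ₐ[ℝ] Module.End ℝ (LDO N n) :=
  ldoMap.comp (normalForm.symm.conjAlgEquiv ℝ).toAlgHom

theorem normalMap_eq (φ : Module.End ℝ (HorPoly N n)) :
    normalMap φ = ldoMap (normalForm.symm.toLinearMap ∘ₗ φ ∘ₗ normalForm.toLinearMap) := rfl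

theorem ldoLeftD_eq_normalMap (i : Fin N) : (ldoLeftD i : Module.End ℝ (LDO N n)) =
    normalMap (LinearMap.mulLeft ℝ (MvPolynomial.X (0, i))) := by
  have h : (normalForm.symm.toLinearMap ∘ₗ LinearMap.mulLeft ℝ (MvPolynomial.X (0, i)) ∘ₗ
      normalForm.toLinearMap : Module.End ℝ (HorPoly N n)) = leftSymb i := by
    refine LinearMap.ext fun Q => ?_
    refine (LinearEquiv.symm_apply_eq _).2 ?_
    exact (normalForm_leftSymb i Q).symm
  rw [normalMap_eq, h]
  refine LinearMap.ext fun A => ?_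
  obtain ⟨c, rfl⟩ := (symbolEquiv N n).surjective A
  rw [ldoMap_apply, LinearEquiv.symm_apply_apply]
  exact Subtype.ext (leftD_op i c)

/-- The projection of `LDO(n)` to the operators whose normal form is free of the `X_{0,i}`. -/
noncomputable def freeProj : Module.End ℝ (LDO N n) := normalMap freePart

theorem chi_eq_zero_iff (A : LDO N n) : chi N n A = 0 ↔ freeProj A = 0 := by
  obtain ⟨c, rfl⟩ := (symbolEquiv N n).surjective A
  have h1 : chi N n (symbolEquiv N n c) = symbolEquiv N n (chiSymb c) := by
    simp [chi]
  rw [h1, freeProj, normalMap_eq, ldoMap_apply, LinearEquiv.symm_apply_apply,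
    LinearEquiv.map_eq_zero_iff, LinearEquiv.map_eq_zero_iff, Subtype.ext_iff, Subtype.ext_iff,
    funext_iff, funext_iff]
  refine forall_congr' fun α => ?_
  change charPoly (polarize (c.1 α)) = 0 ↔ normalForm.symm (freePart (normalForm (c.1 α))) = 0
  rw [LinearEquiv.map_eq_zero_iff, charPoly_eq_freePart_shear, normalForm_apply]

theorem freeProj_ldoLeftD (i : Fin N) (A : LDO N n) : freeProj (ldoLeftD i A) = 0 := by
  rw [ldoLeftD_eq_normalMap, freeProj, ← Module.End.mul_apply, ← map_mul]
  have h : (freePart * LinearMap.mulLeft ℝ (MvPolynomial.X (0, i)) :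
      Module.End ℝ (HorPoly N n)) = 0 := LinearMap.ext fun Q => freePart_X_zero_mul i Q
  rw [h, map_zero]
  rfl

/-- The weighted derivatives with respect to `d/dy_1`, from which the contraction of the Koszul
complex of the operators `A ↦ d/dx^i ∘ A` is built. -/
noncomputable def ldoContr (c : ℝ) (i : Fin N) : Module.End ℝ (LDO N n) :=
  normalMap (weightedD c i)

theorem ldoLeftD_ldoContr (c : ℝ) {i k : Fin N} (hik : i ≠ k) (A : LDO N n) :
    ldoLeftD i (ldoContr c k A) = ldoContr (c - 1) k (ldoLeftD i A) := by
  simp only [ldoLeftD_eq_normalMap, ldoContr, ← Module.End.mul_apply, ← map_mul]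
  congr 2
  exact LinearMap.ext fun Q => X_mul_weightedD c hik Q

theorem ldo_euler_identity (δ : Finset (Fin N)) (A : LDO N n) :
    ∑ i ∈ δ, ldoLeftD i (ldoContr (δᶜ.card : ℝ) i A) +
      ∑ k ∈ δᶜ, ldoContr ((δᶜ.card : ℝ) - 1) k (ldoLeftD k A) =
    A - if δ = Finset.univ then freeProj A else 0 := by
  have h : (∑ i ∈ δ, LinearMap.mulLeft ℝ (MvPolynomial.X (0, i)) * weightedD (δᶜ.card : ℝ) i +
      ∑ k ∈ δᶜ, weightedD ((δᶜ.card : ℝ) - 1) k * LinearMap.mulLeft ℝ (MvPolynomial.X (0, k)) :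
        Module.End ℝ (HorPoly N n)) = 1 - if δ = Finset.univ then freePart else 0 := by
    refine LinearMap.ext fun Q => ?_
    rw [LinearMap.add_apply, LinearMap.sum_apply, LinearMap.sum_apply, LinearMap.sub_apply]
    refine (euler_identity δ Q).trans ?_
    split_ifs <;> rfl
  have h2 := congrArg (fun φ => normalMap φ A) h
  simp only [map_add, map_sum, map_mul, map_sub, map_one, ← ldoLeftD_eq_normalMap] at h2
  rw [LinearMap.add_apply, LinearMap.sum_apply, LinearMap.sum_apply, LinearMap.sub_apply] at h2
  refine h2.trans ?_
  split_ifs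
  · rfl
  · rw [map_zero]
    rfl

end Operators

/-! ### Contraction of the Koszul complex -/

section Koszul

/-- Removing two different elements of `δ` in the two possible orders gives opposite signs. -/
theorem koszul_sign {N : ℕ} {δ : Finset (Fin N)} {i k : Fin N} (hi : i ∈ δ) (hk : k ∉ δ) :
    (-1 : ℝ) ^ (δ.filter (· < i)).card *
        (-1 : ℝ) ^ ((insert k (δ.erase i)).filter (· < k)).card =
      -((-1 : ℝ) ^ ((insert k δ).filter (· < k)).card *
        (-1 : ℝ) ^ ((insert k δ).filter (· < i)).card) := by
  have hne : i ≠ k := by rintro rfl; exact hk hi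
  have e1 : (insert k δ).erase k = δ := Finset.erase_insert hk
  have e2 : (insert k δ).erase i = insert k (δ.erase i) := Finset.erase_insert_of_ne hne.symm
  rw [← pow_add, ← pow_add, ← e2]
  nth_rewrite 1 [← e1]
  have hneg : ∀ a : ℕ, -((-1 : ℝ) ^ a) = (-1) ^ (a + 1) := fun a => by rw [pow_succ]; ring
  -- the two exponents differ by an odd number
  rcases lt_or_gt_of_ne hne with h | h
  · have := card_filter_erase (insert k δ) (Finset.mem_insert_of_mem hi) h
    rw [hneg, neg_one_pow_congr]
    simp only [Nat.even_iff]
    omega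
  · have := card_filter_erase (insert k δ) (Finset.mem_insert_self k δ) h
    rw [hneg, neg_one_pow_congr]
    simp only [Nat.even_iff]
    omega

variable {N n : ℕ}

/-- The differential `w ↦ ∑ dx^i ∧ (d/dx^i ∘ w)` on forms with coefficients in `LDO(n)`. -/
noncomputable def koszulD (w : Finset (Fin N) → LDO N n) (δ : Finset (Fin N)) : LDO N n :=
  ∑ i ∈ δ, (-1 : ℝ) ^ (δ.filter (· < i)).card • ldoLeftD i (w (δ.erase i))

variable [NeZero n]

/-- The contraction of the Koszul complex: the sum of the interior products with the `∂/∂x^i`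
composed with the weighted derivatives. -/
noncomputable def koszulH : (Finset (Fin N) → LDO N n) →ₗ[ℝ] (Finset (Fin N) → LDO N n) :=
  LinearMap.pi fun δ => ∑ k ∈ δᶜ, (-1 : ℝ) ^ ((insert k δ).filter (· < k)).card •
    (ldoContr ((δᶜ.card : ℝ) - 1) k ∘ₗ LinearMap.proj (insert k δ))

theorem koszulH_apply (w : Finset (Fin N) → LDO N n) (δ : Finset (Fin N)) :
    koszulH w δ = ∑ k ∈ δᶜ, (-1 : ℝ) ^ ((insert k δ).filter (· < k)).card •
      ldoContr ((δᶜ.card : ℝ) - 1) k (w (insert k δ)) := by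
  rw [koszulH, LinearMap.pi_apply, LinearMap.sum_apply]
  rfl

/-- The contraction shows that the Koszul complex is acyclic except in top form degree, where its
cohomology is the image of `freeProj`. -/
theorem koszul_homotopy (w : Finset (Fin N) → LDO N n) (δ : Finset (Fin N)) :
    koszulD (koszulH w) δ + koszulH (koszulD w) δ =
      w δ - if δ = Finset.univ then freeProj (w δ) else 0 := by
  have h1 : koszulD (koszulH w) δ = ∑ i ∈ δ, ldoLeftD i (ldoContr (δᶜ.card : ℝ) i (w δ)) +
      ∑ i ∈ δ, ∑ k ∈ δᶜ, ((-1 : ℝ) ^ (δ.filter (· < i)).card *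
        (-1 : ℝ) ^ ((insert k (δ.erase i)).filter (· < k)).card) •
          ldoLeftD i (ldoContr (δᶜ.card : ℝ) k (w (insert k (δ.erase i)))) := by
    rw [koszulD, ← Finset.sum_add_distrib]
    refine Finset.sum_congr rfl fun i hi => ?_
    have hc : (δ.erase i)ᶜ = insert i δᶜ := Finset.compl_erase
    have hi' : i ∉ δᶜ := by simpa using hi
    have hw : (((insert i δᶜ).card : ℕ) : ℝ) - 1 = δᶜ.card := by
      rw [Finset.card_insert_of_notMem hi']
      push_cast
      ring
    rw [koszulH_apply, hc, hw, Finset.sum_insert hi', Finset.insert_erase hi, map_add, smul_add,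
      map_smul, smul_smul, ← pow_add, Even.neg_one_pow ⟨_, rfl⟩, one_smul, map_sum,
      Finset.smul_sum]
    simp only [map_smul, smul_smul]
  have h2 : koszulH (koszulD w) δ =
      ∑ k ∈ δᶜ, ldoContr ((δᶜ.card : ℝ) - 1) k (ldoLeftD k (w δ)) +
      ∑ k ∈ δᶜ, ∑ i ∈ δ, ((-1 : ℝ) ^ ((insert k δ).filter (· < k)).card *
        (-1 : ℝ) ^ ((insert k δ).filter (· < i)).card) •
          ldoContr ((δᶜ.card : ℝ) - 1) k (ldoLeftD i (w ((insert k δ).erase i))) := by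
    rw [koszulH_apply, ← Finset.sum_add_distrib]
    refine Finset.sum_congr rfl fun k hk => ?_
    have hk' : k ∉ δ := by simpa using hk
    rw [koszulD, Finset.sum_insert hk', Finset.erase_insert hk', map_add, smul_add, map_smul,
      smul_smul, ← pow_add, Even.neg_one_pow ⟨_, rfl⟩, one_smul, map_sum, Finset.smul_sum]
    simp only [map_smul, smul_smul]
  have h3 : ∑ k ∈ δᶜ, ∑ i ∈ δ, ((-1 : ℝ) ^ ((insert k δ).filter (· < k)).card *
        (-1 : ℝ) ^ ((insert k δ).filter (· < i)).card) •
          ldoContr ((δᶜ.card : ℝ) - 1) k (ldoLeftD i (w ((insert k δ).erase i))) =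
      -∑ i ∈ δ, ∑ k ∈ δᶜ, ((-1 : ℝ) ^ (δ.filter (· < i)).card *
        (-1 : ℝ) ^ ((insert k (δ.erase i)).filter (· < k)).card) •
          ldoLeftD i (ldoContr (δᶜ.card : ℝ) k (w (insert k (δ.erase i)))) := by
    rw [Finset.sum_comm, ← Finset.sum_neg_distrib]
    refine Finset.sum_congr rfl fun i hi => ?_
    rw [← Finset.sum_neg_distrib]
    refine Finset.sum_congr rfl fun k hk => ?_
    have hk' : k ∉ δ := by simpa using hk
    have hne : i ≠ k := by rintro rfl; exact hk' hi
    rw [koszul_sign hi hk', ldoLeftD_ldoContr _ hne, Finset.erase_insert_of_ne hne.symm, neg_smul,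
      neg_neg]
  rw [h1, h2, h3, ← ldo_euler_identity]
  abel

end Koszul

/-! ### Matrix coefficients of maps of forms -/

section Coefficients

variable {N n : ℕ}

/-- The matrix coefficients of an element of `DEnd_k(n)`, as elements of `LDO(n)`. -/
noncomputable def coef {k : ℤ} :
    DEnd N n k →ₗ[ℝ] ((Fin n → Finset (Fin N)) → Finset (Fin N) → LDO N n) where
  toFun f ε δ := ⟨matCoeff ε δ f.1, (f.2 ε δ).1⟩
  map_add' f g := funext fun ε => funext fun δ => Subtype.ext (map_add (matCoeff ε δ) f.1 g.1)
  map_smul' r f := funext fun ε => funext fun δ => Subtype.ext (map_smul (matCoeff ε δ) r f.1)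

theorem coef_injective {k : ℤ} : Function.Injective (coef (N := N) (n := n) (k := k)) := by
  intro f g h
  refine Subtype.ext (MultilinearMap.pi_ext fun ε => MultilinearMap.ext fun v => funext fun δ => ?_)
  have h1 := congrArg Subtype.val (congrFun (congrFun h ε) δ)
  exact DFunLike.congr_fun h1 v

theorem coef_eq_zero {k : ℤ} (f : DEnd N n k) {ε : Fin n → Finset (Fin N)} {δ : Finset (Fin N)}
    (h : ¬ DegreeMatch k ε δ) : coef f ε δ = 0 :=
  Subtype.ext ((f.2 ε δ).2 h)

/-- The `n`-linear map on forms with given matrix coefficients. -/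
noncomputable def formOpOfCoef
    (c : (Fin n → Finset (Fin N)) → Finset (Fin N) → LDO N n) : FormOp N n :=
  MultilinearMap.pi fun δ => ∑ ε, (c ε δ).1.compLinearMap fun j =>
    LinearMap.proj (R := ℝ) (φ := fun _ : Finset (Fin N) => Loc N) (ε j)

theorem matCoeff_formOpOfCoef (c : (Fin n → Finset (Fin N)) → Finset (Fin N) → LDO N n)
    (ε : Fin n → Finset (Fin N)) (δ : Finset (Fin N)) :
    matCoeff ε δ (formOpOfCoef c) = (c ε δ).1 := by
  refine MultilinearMap.ext fun h => ?_
  rw [matCoeff_apply, formOpOfCoef, MultilinearMap.pi_apply, _root_.sum_apply,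
    Finset.sum_eq_single ε]
  · rw [MultilinearMap.compLinearMap_apply]
    congr 1
    funext j
    simp
  · intro ε' _ hne
    obtain ⟨j, hj⟩ := Function.ne_iff.1 hne
    rw [MultilinearMap.compLinearMap_apply]
    refine MultilinearMap.map_coord_zero _ j ?_
    rw [LinearMap.proj_apply, Pi.single_eq_of_ne hj]
  · intro h
    exact absurd (Finset.mem_univ _) h

/-- The element of `DEnd_k(n)` with given matrix coefficients. -/
noncomputable def ofCoef (k : ℤ) (c : (Fin n → Finset (Fin N)) → Finset (Fin N) → LDO N n)
    (hc : ∀ ε δ, ¬ DegreeMatch k ε δ → c ε δ = 0) : DEnd N n k :=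
  ⟨formOpOfCoef c, fun ε δ => by
    rw [matCoeff_formOpOfCoef]
    exact ⟨(c ε δ).2, fun h => congrArg Subtype.val (hc ε δ h)⟩⟩

theorem coef_ofCoef (k : ℤ) (c : (Fin n → Finset (Fin N)) → Finset (Fin N) → LDO N n)
    (hc : ∀ ε δ, ¬ DegreeMatch k ε δ → c ε δ = 0) : coef (ofCoef k c hc) = c :=
  funext fun ε => funext fun δ => Subtype.ext (matCoeff_formOpOfCoef c ε δ)

/-- The matrix coefficients of `f ∘ d_H^{⊗n}` in terms of those of `f`. -/
noncomputable def tensorCoef (c : (Fin n → Finset (Fin N)) → Finset (Fin N) → LDO N n)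
    (ε : Fin n → Finset (Fin N)) (δ : Finset (Fin N)) : LDO N n :=
  ∑ j, (∏ l, if l < j then (-1 : ℝ) ^ (N - (ε l).card) else 1) •
    ∑ i ∈ (ε j)ᶜ, (-1 : ℝ) ^ ((insert i (ε j)).filter (· < i)).card •
      ldoRightD i j (c (Function.update ε j (insert i (ε j))) δ)

theorem matCoeff_preDelta (k : ℤ) (f : FormOp N n) (ε : Fin n → Finset (Fin N))
    (δ : Finset (Fin N)) : matCoeff ε δ (preDelta N n k f) =
      ∑ i ∈ δ, (-1 : ℝ) ^ (δ.filter (· < i)).card • leftD i (matCoeff ε (δ.erase i) f) -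
      (-1 : ℝ) ^ k • ∑ j, (∏ l, if l < j then (-1 : ℝ) ^ (N - (ε l).card) else 1) •
        ∑ i ∈ (ε j)ᶜ, (-1 : ℝ) ^ ((insert i (ε j)).filter (· < i)).card •
          rightD i j (matCoeff (Function.update ε j (insert i (ε j))) δ f) := by
  refine MultilinearMap.ext fun h => ?_
  rw [matCoeff_apply, preDelta_apply, Pi.sub_apply, dH_apply, _root_.sub_apply, _root_.sum_apply,
    Pi.smul_apply, _root_.smul_apply, _root_.sum_apply, Finset.sum_apply]
  congr 2
  refine Finset.sum_congr rfl fun j _ => ?_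
  -- the sign of the grading involution is pulled out of each argument before the `j`-th
  have e1 : (fun l => tensorArg j l (Pi.single (ε l) (h l) : Form N)) = fun l =>
      (if l < j then (-1 : ℝ) ^ (N - (ε l).card) else 1) •
        Function.update (fun l => (Pi.single (ε l) (h l) : Form N)) j
          (dH N (Pi.single (ε j) (h j))) l := by
    funext l
    by_cases hl : l = j
    · subst hl
      simp [tensorArg]
    · rw [Function.update_of_ne hl, tensorArg]
      by_cases hlt : l < j
      · rw [if_pos hlt, if_pos hlt]
        funext δ
        rw [gradInv_apply, Pi.smul_apply]
        by_cases hδ : δ = ε l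
        · rw [hδ]
        · rw [Pi.single_eq_of_ne hδ, smul_zero, smul_zero]
      · rw [if_neg hlt, if_neg hlt, if_neg hl, one_smul]
        rfl
  rw [e1, MultilinearMap.map_smul_univ, dH_single, MultilinearMap.map_update_sum, Pi.smul_apply,
    Finset.sum_apply, _root_.smul_apply, _root_.sum_apply]
  congr 1
  refine Finset.sum_congr rfl fun i _ => ?_
  rw [MultilinearMap.map_update_smul, Pi.smul_apply, _root_.smul_apply, rightD_apply,
    matCoeff_apply]
  congr 1
  refine congrArg (fun q => f q δ) (funext fun l => ?_)
  by_cases hl : l = j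
  · subst hl
    simp
  · simp [hl]

theorem coef_delta {k l : ℤ} (hkl : l + 1 = k) (f : DEnd N n k) (ε : Fin n → Finset (Fin N))
    (δ : Finset (Fin N)) : coef (delta N n k l hkl f) ε δ =
      koszulD (coef f ε) δ - (-1 : ℝ) ^ k • tensorCoef (coef f) ε δ := by
  let ι : LDO N n →ₗ[ℝ] MultiOp N n := (ldoSubmodule N n).subtype
  refine Subtype.ext ((matCoeff_preDelta k f.1 ε δ).trans ?_)
  change _ = ι (koszulD (coef f ε) δ - (-1 : ℝ) ^ k • tensorCoef (coef f) ε δ)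
  simp only [koszulD, tensorCoef, map_sub, map_smul, map_sum]
  rfl

/-- The degree of `(dx)^{ε_1} ⊗ ⋯ ⊗ (dx)^{ε_n}` in `Ω_*^{⊗n}`. -/
def srcDeg (ε : Fin n → Finset (Fin N)) : ℤ := ∑ j, ((N : ℤ) - (ε j).card)

theorem srcDeg_le (ε : Fin n → Finset (Fin N)) : srcDeg ε ≤ n * N := by
  refine (Finset.sum_le_sum (g := fun _ => (N : ℤ)) fun j _ => by simp).trans ?_
  simp

theorem srcDeg_update (ε : Fin n → Finset (Fin N)) (j : Fin n) {i : Fin N} (hi : i ∈ (ε j)ᶜ) :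
    srcDeg (Function.update ε j (insert i (ε j))) = srcDeg ε - 1 := by
  rw [srcDeg, srcDeg, ← Finset.add_sum_erase _ _ (Finset.mem_univ j),
    ← Finset.add_sum_erase (a := j) _ (fun l => (N : ℤ) - (ε l).card) (Finset.mem_univ j),
    Function.update_self, Finset.card_insert_of_notMem (Finset.mem_compl.1 hi),
    Finset.sum_congr (g := fun l => (N : ℤ) - (ε l).card) rfl fun l hl => by
      rw [Function.update_of_ne (Finset.ne_of_mem_erase hl)]]
  push_cast
  ring

/-- The coefficients on the part of `Ω_*^{⊗n}` of degree less than `s` are zero. -/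
def VanishesBelow (s : ℤ) (c : (Fin n → Finset (Fin N)) → Finset (Fin N) → LDO N n) : Prop :=
  ∀ ε δ, srcDeg ε < s → c ε δ = 0

theorem VanishesBelow.tensorCoef {s : ℤ}
    {c : (Fin n → Finset (Fin N)) → Finset (Fin N) → LDO N n} (hc : VanishesBelow s c) :
    VanishesBelow (s + 1) (JetLDO.tensorCoef c) := by
  intro ε δ hε
  refine Finset.sum_eq_zero fun j _ => ?_
  rw [Finset.sum_eq_zero, smul_zero]
  intro i hi
  rw [hc _ _ (by rw [srcDeg_update ε j hi]; omega), map_zero, smul_zero]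

theorem vanishesBelow_zero (c : (Fin n → Finset (Fin N)) → Finset (Fin N) → LDO N n) :
    VanishesBelow 0 c := by
  intro ε δ h
  refine absurd h (not_lt.2 (Finset.sum_nonneg fun j _ => ?_))
  have := Finset.card_le_univ (ε j)
  rw [Fintype.card_fin] at this
  omega

theorem eq_univ_of_srcDeg_lt_one {ε : Fin n → Finset (Fin N)} (h : srcDeg ε < 1) (j : Fin n) :
    ε j = Finset.univ := by
  have h0 : ∀ l ∈ Finset.univ, (0 : ℤ) ≤ (N : ℤ) - (ε l).card := fun l _ => by
    have := Finset.card_le_univ (ε l)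
    rw [Fintype.card_fin] at this
    omega
  have h1 := Finset.single_le_sum h0 (Finset.mem_univ j)
  have h2 := h0 j (Finset.mem_univ j)
  rw [srcDeg] at h
  refine (Finset.card_eq_iff_eq_univ _).1 ?_
  rw [Fintype.card_fin]
  omega

/-- An element of `DEnd_l(n)` that vanishes in source degrees up to `-l` has no component with values in
top forms. -/
theorem coef_univ_eq_zero {l s : ℤ} (hsl : -l < s) {c : DEnd N n l}
    (hs : VanishesBelow s (coef c)) (ε : Fin n → Finset (Fin N)) :
    coef c ε Finset.univ = 0 := by
  by_cases h : DegreeMatch l ε Finset.univ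
  · refine hs ε _ ?_
    unfold DegreeMatch at h
    rw [Finset.card_univ, Fintype.card_fin] at h
    change _ = srcDeg ε + l at h
    omega
  · exact coef_eq_zero c h

theorem bZero_eq_coef (f : DEnd N n 0) :
    bZero N n f = coef f (fun _ => Finset.univ) Finset.univ := rfl

end Coefficients

/-! ### Induction on the source degree -/

section Exactness

variable {N n : ℕ} [NeZero n]

/-- The contraction of the Koszul complex acting on the target of the elements of `DEnd_k(n)`. -/
noncomputable def contract {k l : ℤ} (hkl : l + 1 = k) (c : DEnd N n l) : DEnd N n k :=
  ofCoef k (fun ε => koszulH (coef c ε)) fun ε δ h => by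
    rw [koszulH_apply]
    refine Finset.sum_eq_zero fun i hi => ?_
    rw [coef_eq_zero, map_zero, smul_zero]
    intro h'
    apply h
    unfold DegreeMatch at h' ⊢
    rw [Finset.card_insert_of_notMem (Finset.mem_compl.1 hi)] at h'
    push_cast at h'
    omega

theorem coef_contract {k l : ℤ} (hkl : l + 1 = k) (c : DEnd N n l) :
    coef (contract hkl c) = fun ε => koszulH (coef c ε) := coef_ofCoef _ _ _

theorem vanishesBelow_contract {k l : ℤ} (hkl : l + 1 = k) {c : DEnd N n l} {s : ℤ}
    (hs : VanishesBelow s (coef c)) : VanishesBelow s (coef (contract hkl c)) := by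
  intro ε δ hε
  rw [coef_contract]
  have h : coef c ε = 0 := funext fun δ => hs ε δ hε
  simp [h]

/-- Subtracting the boundary of its contraction from a cycle raises by one the source degree in
which the cycle starts, provided that the contraction meets no cohomology of the Koszul complex. -/
theorem vanishesBelow_sub_delta_contract {k l m : ℤ} (hkl : l + 1 = k) (hlm : m + 1 = l)
    {c : DEnd N n l} (hc : delta N n l m hlm c = 0) {s : ℤ} (hs : VanishesBelow s (coef c))
    (hP : ∀ ε, freeProj (coef c ε Finset.univ) = 0) :
    VanishesBelow (s + 1) (coef (c - delta N n k l hkl (contract hkl c))) := by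
  intro ε δ hε
  have hcyc : koszulD (coef c ε) = 0 := by
    funext δ
    have h := coef_delta hlm c ε δ
    rw [hc, map_zero, hs.tensorCoef ε δ hε, smul_zero, sub_zero] at h
    exact h.symm
  have hhom := koszul_homotopy (coef c ε) δ
  rw [hcyc, map_zero, Pi.zero_apply, add_zero] at hhom
  rw [map_sub, Pi.sub_apply, Pi.sub_apply, coef_delta,
    (vanishesBelow_contract hkl hs).tensorCoef ε δ hε, smul_zero, sub_zero, coef_contract, hhom]
  split_ifs with hδ
  · rw [hδ, hP, sub_zero, sub_self]
  · rw [sub_zero, sub_self]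

/-- The induction on the source degree: `t` bounds the number of source degrees from `s` on, and
`s > -l` excludes components with values in top forms. -/
theorem exists_delta_eq_of_lt {k l m : ℤ} (hkl : l + 1 = k) (hlm : m + 1 = l) (t : ℕ) :
    ∀ {s : ℤ} (c : DEnd N n l), -l < s → n * N < s + t → delta N n l m hlm c = 0 →
      VanishesBelow s (coef c) →
        ∃ g : DEnd N n k, delta N n k l hkl g = c ∧ VanishesBelow s (coef g) := by
  induction t with
  | zero =>
    intro s c _ hst _ hs
    have h0 : c = 0 := coef_injective (by
      rw [map_zero]
      exact funext fun ε => funext fun δ => hs ε δ (by have := srcDeg_le ε; omega))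
    refine ⟨0, by rw [map_zero, h0], fun ε δ _ => by simp⟩
  | succ t ih =>
    intro s c hsl hst hc hs
    have h1 := vanishesBelow_sub_delta_contract hkl hlm hc hs fun ε => by
      rw [coef_univ_eq_zero hsl hs, map_zero]
    obtain ⟨g, hg, hgs⟩ := ih (s := s + 1) _ (by omega) (by push_cast at hst ⊢; omega)
      (by rw [map_sub, hc, delta_delta, sub_zero]) h1
    refine ⟨g + contract hkl c, by rw [map_add, hg, sub_add_cancel], fun ε δ hε => ?_⟩
    rw [map_add, Pi.add_apply, Pi.add_apply, hgs ε δ (by omega),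
      vanishesBelow_contract hkl hs ε δ hε, add_zero]

/-- A cycle of degree `l` which vanishes in source degrees below `s ≥ -l` is a boundary if its
coefficients in top forms have zero characteristic. -/
theorem exists_delta_eq {k l m : ℤ} (hkl : l + 1 = k) (hlm : m + 1 = l) {s : ℤ} (hsl : -l ≤ s)
    {c : DEnd N n l} (hc : delta N n l m hlm c = 0) (hs : VanishesBelow s (coef c))
    (hP : ∀ ε, chi N n (coef c ε Finset.univ) = 0) :
    ∃ g : DEnd N n k, delta N n k l hkl g = c ∧ VanishesBelow s (coef g) := by
  have h1 := vanishesBelow_sub_delta_contract hkl hlm hc hs fun ε => (chi_eq_zero_iff _).1 (hP ε)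
  obtain ⟨g, hg, hgs⟩ := exists_delta_eq_of_lt hkl hlm (n * N + 1 - s).toNat (s := s + 1)
    (c - delta N n k l hkl (contract hkl c)) (by omega)
    (by have := Int.self_le_toNat ((n * N + 1 : ℤ) - s); omega)
    (by rw [map_sub, hc, delta_delta, sub_zero]) h1
  refine ⟨g + contract hkl c, by rw [map_add, hg, sub_add_cancel], fun ε δ hε => ?_⟩
  rw [map_add, Pi.add_apply, Pi.add_apply, hgs ε δ (by omega),
    vanishesBelow_contract hkl hs ε δ hε, add_zero]

end Exactness

/-! ### Cycles, boundaries and `Ker(a₀)` -/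

section Homology

variable {N n : ℕ} [NeZero n]

theorem freeProj_koszulD (w : Finset (Fin N) → LDO N n) (δ : Finset (Fin N)) :
    freeProj (koszulD w δ) = 0 := by
  rw [koszulD, map_sum]
  exact Finset.sum_eq_zero fun i _ => by rw [map_smul, freeProj_ldoLeftD, smul_zero]

theorem mem_ker_aZero_iff (A : LDO N n) :
    A ∈ LinearMap.ker (aZero N n) ↔ ∀ i j, freeProj (ldoRightD i j A) = 0 := by
  rw [LinearMap.mem_ker, funext_iff]
  refine forall_congr' fun i => ?_
  rw [funext_iff]
  exact forall_congr' fun j => chi_eq_zero_iff _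

theorem ker_chi_le_ker_aZero : LinearMap.ker (chi N n) ≤ LinearMap.ker (aZero N n) := by
  intro A hA
  rw [LinearMap.mem_ker, chi_eq_zero_iff] at hA
  -- an operator with zero characteristic is a total divergence
  have h := ldo_euler_identity Finset.univ A
  rw [if_pos rfl, hA, sub_zero, Finset.compl_univ, Finset.sum_empty, add_zero] at h
  rw [mem_ker_aZero_iff]
  intro i j
  rw [← h, map_sum, map_sum]
  exact Finset.sum_eq_zero fun k _ => by rw [ldoRightD_ldoLeftD, freeProj_ldoLeftD]

theorem bZero_mem_ker_aZero {f : DEnd N n 0} (hf : f ∈ cycles N n 0) :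
    bZero N n f ∈ LinearMap.ker (aZero N n) := by
  rw [mem_ker_aZero_iff]
  intro i j
  -- the argument `dx^1 ∧ ⋯ ∧ dx^N` in each place except the `j`-th, where `dx^i` is left out
  let ε : Fin n → Finset (Fin N) := Function.update (fun _ => Finset.univ) j {i}ᶜ
  have hj : (ε j)ᶜ = {i} := by simp [ε]
  have hl : ∀ l ≠ j, (ε l)ᶜ = ∅ := fun l hl => by simp [ε, hl]
  have hε : Function.update ε j (insert i (ε j)) = fun _ => Finset.univ := by
    simp [ε, Function.update_eq_self]
  have h := congrArg freeProj (coef_delta (by omega : (0 : ℤ) - 1 + 1 = 0) f ε Finset.univ)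
  rw [show delta N n 0 (0 - 1) _ f = 0 from hf, map_zero, map_sub, freeProj_koszulD, tensorCoef,
    Finset.sum_eq_single j (fun l _ hlj => by rw [hl l hlj, Finset.sum_empty, smul_zero])
      (fun h => absurd (Finset.mem_univ j) h), hj, Finset.sum_singleton, hε, map_smul, map_smul,
    map_smul, zero_sub, Pi.zero_apply, Pi.zero_apply, map_zero, eq_comm, neg_eq_zero] at h
  have hne : ∀ a : ℕ, (-1 : ℝ) ^ a ≠ 0 := fun a => pow_ne_zero a (by norm_num)
  have h' := (smul_eq_zero.1 h).resolve_left (by norm_num)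
  refine (smul_eq_zero.1 ((smul_eq_zero.1 h').resolve_left ?_)).resolve_left (hne _)
  refine Finset.prod_ne_zero_iff.2 fun l _ => ?_
  split_ifs
  · exact hne _
  · exact one_ne_zero

theorem chi_bZero_of_mem_boundaries {f : DEnd N n 0} (hf : f ∈ boundaries N n 0) :
    chi N n (bZero N n f) = 0 := by
  obtain ⟨g, rfl⟩ := hf
  rw [chi_eq_zero_iff, bZero_eq_coef, coef_delta, map_sub, freeProj_koszulD, map_smul, tensorCoef]
  simp

theorem mem_boundaries_of_chi_bZero {f : DEnd N n 0} (hf : f ∈ cycles N n 0)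
    (h : chi N n (bZero N n f) = 0) : f ∈ boundaries N n 0 := by
  obtain ⟨g, hg, -⟩ := exists_delta_eq (k := 0 + 1) rfl (by omega : (0 : ℤ) - 1 + 1 = 0)
    (s := 0) (by omega) hf (vanishesBelow_zero _) fun ε => by
      by_cases hd : DegreeMatch 0 ε Finset.univ
      · have hε : ε = fun _ => Finset.univ := funext fun j => eq_univ_of_srcDeg_lt_one (by
          unfold DegreeMatch at hd
          rw [Finset.card_univ, Fintype.card_fin] at hd
          change _ = srcDeg ε + 0 at hd
          omega) j
        rw [hε, ← bZero_eq_coef, h]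
      · rw [coef_eq_zero f hd, map_zero]
  exact ⟨g, hg⟩

/-- Each operator in `Ker(a₀)` extends from the top forms to a `0`-cycle. -/
theorem exists_cycle_bZero_eq {A : LDO N n} (hA : A ∈ LinearMap.ker (aZero N n)) :
    ∃ f ∈ cycles N n 0, bZero N n f = A := by
  classical
  rw [mem_ker_aZero_iff] at hA
  -- `A` on top forms, extended by zero
  let f₀ : DEnd N n 0 := ofCoef 0
    (fun ε δ => if (∀ j, ε j = Finset.univ) ∧ δ = Finset.univ then A else 0) fun ε δ h => by
      refine if_neg fun h' => h ?_
      unfold DegreeMatch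
      rw [h'.2, Finset.sum_eq_zero fun j _ => by rw [h'.1 j]; simp]
      simp
  have hf₀ : coef f₀ = _ := coef_ofCoef _ _ _
  have hl : (0 : ℤ) - 1 + 1 = 0 := by omega
  have hm : (0 : ℤ) - 1 - 1 + 1 = 0 - 1 := by omega
  obtain ⟨g, hg, hgs⟩ := exists_delta_eq hl hm (s := 1) (by omega)
    (c := delta N n 0 (0 - 1) hl f₀) (delta_delta hl hm f₀) (fun ε δ hε => by
      have hε' := eq_univ_of_srcDeg_lt_one hε
      rw [coef_delta, hf₀, koszulD, Finset.sum_eq_zero fun i hi => ?_, tensorCoef,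
        Finset.sum_eq_zero fun j _ => ?_, smul_zero, sub_zero]
      · rw [hε' j, Finset.compl_univ, Finset.sum_empty, smul_zero]
      · beta_reduce
        rw [if_neg, map_zero, smul_zero]
        intro h
        have := Finset.mem_univ i
        rw [← h.2] at this
        exact Finset.notMem_erase i δ this) fun ε => by
      rw [chi_eq_zero_iff, coef_delta, map_sub, freeProj_koszulD, zero_sub, neg_eq_zero, map_smul,
        tensorCoef, map_sum, Finset.sum_eq_zero fun j _ => ?_, smul_zero]
      rw [map_smul, map_sum, Finset.sum_eq_zero fun i _ => ?_, smul_zero]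
      rw [map_smul, hf₀]
      beta_reduce
      split_ifs
      · rw [hA, smul_zero]
      · rw [map_zero, map_zero, smul_zero]
  refine ⟨f₀ - g, ?_, ?_⟩
  · change delta N n 0 (0 - 1) hl (f₀ - g) = 0
    rw [map_sub, hg, sub_self]
  · rw [map_sub, bZero_eq_coef, bZero_eq_coef, hgs _ _ (by simp [srcDeg]), hf₀, sub_zero]
    exact if_pos ⟨fun _ => rfl, rfl⟩

theorem subsingleton_homology {k : ℤ} (hk : 0 < k) : Subsingleton (Homology N n k) := by
  rw [Submodule.Quotient.subsingleton_iff, Submodule.submoduleOf_eq_top]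
  intro f hf
  have hl : k - 1 + 1 = k := by omega
  obtain ⟨g, hg, -⟩ := exists_delta_eq_of_lt (k := k + 1) rfl hl (n * N + 1) (s := 0) f (by omega)
    (by push_cast; omega) hf (vanishesBelow_zero _)
  exact ⟨g, hg⟩

end Homology

end JetLDO

theorem theorem4p8 (N n : ℕ) [NeZero n] :
    (∀ k : ℤ, 0 < k → Subsingleton (JetLDO.Homology N n k)) ∧
    LinearMap.ker (JetLDO.chi N n) ≤ LinearMap.ker (JetLDO.aZero N n) ∧
    (∃ Φ : JetLDO.Homology N n 0 ≃ₗ[ℝ]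
        LinearMap.ker (JetLDO.aZero N n) ⧸
          (LinearMap.ker (JetLDO.chi N n)).submoduleOf (LinearMap.ker (JetLDO.aZero N n)),
      ∀ f : JetLDO.cycles N n 0, ∃ hf : JetLDO.bZero N n f ∈ LinearMap.ker (JetLDO.aZero N n),
        Φ (Submodule.Quotient.mk f) = Submodule.Quotient.mk ⟨JetLDO.bZero N n f, hf⟩) ∧
    (JetLDO.cycles N n 0).map (JetLDO.bZero N n) = LinearMap.ker (JetLDO.aZero N n) := by
  refine ⟨fun k hk => JetLDO.subsingleton_homology hk, JetLDO.ker_chi_le_ker_aZero, ?_, ?_⟩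
  · let β : JetLDO.cycles N n 0 →ₗ[ℝ] LinearMap.ker (JetLDO.aZero N n) :=
      (JetLDO.bZero N n).restrict fun f hf => JetLDO.bZero_mem_ker_aZero hf
    let Φ := Submodule.mapQ
      ((JetLDO.boundaries N n 0).submoduleOf (JetLDO.cycles N n 0))
      ((LinearMap.ker (JetLDO.chi N n)).submoduleOf (LinearMap.ker (JetLDO.aZero N n))) β
      fun f hf => JetLDO.chi_bZero_of_mem_boundaries hf
    have hΦ : Function.Bijective Φ := by
      constructor
      · rw [injective_iff_map_eq_zero]
        intro x hx
        obtain ⟨f, rfl⟩ := Submodule.Quotient.mk_surjective _ x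
        have h := (Submodule.Quotient.mk_eq_zero _).1 hx
        exact (Submodule.Quotient.mk_eq_zero _).2 (JetLDO.mem_boundaries_of_chi_bZero f.2 h)
      · intro y
        obtain ⟨A, rfl⟩ := Submodule.Quotient.mk_surjective _ y
        obtain ⟨f, hf, hfA⟩ := JetLDO.exists_cycle_bZero_eq A.2
        refine ⟨Submodule.Quotient.mk ⟨f, hf⟩, ?_⟩
        exact congrArg Submodule.Quotient.mk (Subtype.ext hfA)
    exact ⟨LinearEquiv.ofBijective Φ hΦ, fun f => ⟨JetLDO.bZero_mem_ker_aZero f.2, rfl⟩⟩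
  · refine le_antisymm ?_ fun A hA => ?_
    · rintro _ ⟨f, hf, rfl⟩
      exact JetLDO.bZero_mem_ker_aZero hf
    · obtain ⟨f, hf, rfl⟩ := JetLDO.exists_cycle_bZero_eq hA
      exact ⟨f, hf, rfl⟩
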